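/- Let $\theta_1,\dots,\theta_K\in[0,2\pi)$ be distinct, $m_1,\dots,m_K$ positive integers and $d=\sum_j m_j$. Let $H$ be the Laurent polynomial with $$H(e^{i\theta})=\prod_{j=1}^K(1-\cos(\theta-\theta_j))^{m_j}=\sum_{l=-d}^{d}h_le^{il\theta},\qquad Z_H=\frac1{2\pi}\int_0^{2\pi}H(e^{i\theta})\,d\theta,\qquad V(x)=-\frac1{Z_H}\sum_{1\le|l|\le d}\frac{h_l}{|l|}x^l .$$ For a sequence $\alpha=(\alpha_n)_{n\ge0}$ in the open unit disk $\mathbb D$ put $\alpha_{-1}=-1$ and $\rho_n=\sqrt{1-|\alpha_n|^2}$, and let $U_N$ be the $N\times N$ corner of the GGT matrix: for $0\le k,l\le N-1$, $(U_N)_{kl}=-\alpha_{k-1}\overline{\alpha_l}\prod_{j=k}^{l-1}\rho_j$ if $k\le l$, $(U_N)_{kl}=\rho_l$ if $k=l+1$, and $(U_N)_{kl}=0$ if $k\ge l+2$. In $V(U_N)$ the power $x^{-l}$ ($l>0$) is replaced by $(U_N^*)^{l}$. Call a polynomial $G$ in $\alpha_0,\dots,\alpha_d$ and $\overline{\alpha_0},\dots,\overline{\alpha_d}$,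 each of whose monomials has as many factors $\alpha_i$ as factors $\overline{\alpha_i}$, admissible if for every $\alpha\in\mathbb D^\infty$ the difference $$\mathrm{Tr}\,V(U_N)-\sum_{j=0}^{N-1-d}G(\alpha_j,\dots,\alpha_{j+d})$$ is bounded in $N$. Let $G_{2k}$ be its homogeneous part of degree $2k$. For $k\ge1$ let $A_{2k}=\mathbb C[x_1,y_1,\dots,x_k,y_k]$, $\widetilde A_{2k}=\mathbb C[x_1^{\pm1},y_1^{\pm1},\dots,x_k^{\pm1},y_k^{\pm1}]$ and $\widetilde B_{2k}=\widetilde A_{2k}/(\prod_{i=1}^kx_iy_i-1)$. Say that $P\in A_{2k}$ represents $G_{2k}$ if $[\phi_{2k}(P)]_n=G_{2k}(\alpha_n,\dots,\alpha_{n+d})$ for all $\alpha\in\mathbb D^\infty$ and all $n\ge0$, where $\phi_{2k}$ is the linear map with $[\phi_{2k}(\prod_ix_i^{\beta_i}y_i^{\gamma_i})]_n=\prod_i\alpha_{n+\beta_i}\overline{\alpha_{n+\gamma_i}}$. For $1\le p\le k$ put $a_{k,p}=\prod_{s=p}^ky_s\prod_{s=p+1}^kx_s$, $b_{k,p}=\prod_{s=1}^px_sy_s$,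 and $$G'_{2k}=\frac{(-1)^{k+1}}{kZ_H}\sum_{1\le p,q\le k}\frac{H(a_{k,p}b_{k,q})}{\prod_{s\ne p}\left(1-\frac{a_{k,s}}{a_{k,p}}\right)\prod_{t\ne q}\left(\frac{b_{k,q}}{b_{k,t}}-1\right)}-\frac1k .$$ Theorem. Admissible $G$ exist, and one can be chosen of degree at most $2d$. For every $k\ge1$ the rational function $G'_{2k}$ lies in $\widetilde A_{2k}$, and for every admissible $G$: (i) $G_{2k}$ is represented by some $P\in A_{2k}$ that has the same image in $\widetilde B_{2k}$ as $G'_{2k}$; (ii) for every $P\in A_{2k}$ that represents $G_{2k}$, the sum of $P$ over all permutations of $x_1,\dots,x_k$ and all permutations of $y_1,\dots,y_k$ has the same image in $\widetilde B_{2k}$ as the sum of the expressions $G'_{2k}$ formed from the variables so permuted. -/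

import Mathlib

namespace HigherOrderSumRule

noncomputable section

open scoped ComplexConjugate

/-! ### The trigonometric weight `H`, its coefficients, and `Z_H` -/

section Weight

variable {K : ℕ} (θ : Fin K → ℝ) (m : Fin K → ℕ)

/-- `d = ∑ m_j`. -/
def order (m : Fin K → ℕ) : ℕ := ∑ j, m j

/-- `H` as a Laurent polynomial in `T = e^{iθ}`:
`1 - cos (θ - θ_j) = 1 - (e^{-iθ_j} T + e^{iθ_j} T⁻¹) / 2`. -/
def hPoly : LaurentPolynomial ℂ :=
  ∏ j, (1 - (LaurentPolynomial.C (Complex.exp (-(θ j * Complex.I)) / 2) * LaurentPolynomial.T 1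
    + LaurentPolynomial.C (Complex.exp (θ j * Complex.I) / 2) * LaurentPolynomial.T (-1))) ^ m j

/-- The coefficient `h_l` of `H`. -/
def hCoeff (l : ℤ) : ℂ := (hPoly θ m).coeff l

/-- The value `H(z) = ∑_{l=-d}^{d} h_l z^l` at an element of a field containing `ℂ`. -/
def hEval {F : Type*} [Field F] [Algebra ℂ F] (z : F) : F :=
  ∑ l ∈ Finset.Icc (-(order m : ℤ)) (order m), algebraMap ℂ F (hCoeff θ m l) * z ^ l

/-- `Z_H = (1 / 2π) ∫_0^{2π} ∏ (1 - cos (t - θ_j))^{m_j} dt`. -/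
def zH : ℝ :=
  1 / (2 * Real.pi) * ∫ t in (0 : ℝ)..(2 * Real.pi), ∏ j, (1 - Real.cos (t - θ j)) ^ m j

end Weight

/-! ### The truncated GGT matrix and `Tr V(U_N)` -/

/-- Verblunsky coefficients indexed by `ℤ`: `α_{-1} = -1` and `α_n = 0` for `n < -1`. -/
def extend (α : ℕ → ℂ) (n : ℤ) : ℂ :=
  if 0 ≤ n then α n.toNat else if n = -1 then -1 else 0

/-- `ρ_n = √(1 - |α_n|²)`. -/
def rho (α : ℕ → ℂ) (n : ℕ) : ℝ := Real.sqrt (1 - ‖α n‖ ^ 2)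

/-- The `N × N` top-left corner `U_N` of the GGT matrix. -/
def ggt (α : ℕ → ℂ) (N : ℕ) : Matrix (Fin N) (Fin N) ℂ :=
  Matrix.of fun k l =>
    if (k : ℕ) ≤ l then
      -extend α ((k : ℤ) - 1) * conj (α l) * ∏ j ∈ Finset.Ico (k : ℕ) l, (rho α j : ℂ)
    else if (k : ℕ) = l + 1 then (rho α l : ℂ)
    else 0

/-- `V(U) = -(1 / Z_H) ∑_{1 ≤ |l| ≤ d} (h_l / |l|) U^l` for a square matrix `U`; as `V` is a
function on the unit circle, `x^{-l}` is `(conj x)^l` and negative powers of `U` stand for powers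
of the adjoint. -/
def vMatrix {K : ℕ} (θ : Fin K → ℝ) (m : Fin K → ℕ) {N : ℕ} (U : Matrix (Fin N) (Fin N) ℂ) :
    Matrix (Fin N) (Fin N) ℂ :=
  (-1 / (zH θ m : ℂ)) • ∑ l ∈ Finset.Icc 1 (order m),
    ((hCoeff θ m (l : ℤ) / (l : ℂ)) • U ^ l
      + (hCoeff θ m (-(l : ℤ)) / (l : ℂ)) • U.conjTranspose ^ l)

/-! ### Local polynomials `G(α_j, …, α_{j+d})` -/

/-- Polynomials in `α_0, …, α_d` (left variables) and their conjugates (right variables). -/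
abbrev LocalPoly (d : ℕ) : Type := MvPolynomial (Fin (d + 1) ⊕ Fin (d + 1)) ℂ

/-- `G(α_j, …, α_{j+d})`. -/
def localValue {d : ℕ} (G : LocalPoly d) (α : ℕ → ℂ) (j : ℕ) : ℂ :=
  MvPolynomial.eval
    (Sum.elim (fun i : Fin (d + 1) => α (j + i)) (fun i : Fin (d + 1) => conj (α (j + i)))) G

/-- Every monomial of `G` has as many factors `α_i` as factors `conj α_i`. -/
def Balanced {d : ℕ} (G : LocalPoly d) : Prop :=
  ∀ e ∈ G.support, ∑ i, e (Sum.inl i) = ∑ i, e (Sum.inr i)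

/-- `G` is a choice of local polynomial for `Tr V(U_N)`:
`Tr V(U_N) = bdy + ∑_{j=0}^{N-1-d} G(α_j, …, α_{j+d})` with `bdy` bounded independently of `N`. -/
def IsTraceLocal {K : ℕ} (θ : Fin K → ℝ) (m : Fin K → ℕ) (G : LocalPoly (order m)) : Prop :=
  Balanced G ∧
  ∀ α : ℕ → ℂ, (∀ n, ‖α n‖ < 1) → ∃ C : ℝ, ∀ N : ℕ,
    ‖(vMatrix θ m (ggt α N)).trace - ∑ j ∈ Finset.range (N - order m), localValue G α j‖ ≤ C

/-! ### The algebra model -/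

section Algebra

variable (k : ℕ)

/-- `A_{2k} = ℂ[x_1, y_1, …, x_k, y_k]`, with `x_i` the left and `y_i` the right variables. -/
abbrev PolyRing : Type := MvPolynomial (Fin k ⊕ Fin k) ℂ

/-- The field of rational functions in `x_1, y_1, …, x_k, y_k`. -/
abbrev RatField : Type := FractionRing (PolyRing k)

variable {k}

/-- `x_i` as a rational function. -/
def xVar (i : Fin k) : RatField k := algebraMap (PolyRing k) (RatField k) (MvPolynomial.X (Sum.inl i))

/-- `y_i` as a rational function. -/
def yVar (i : Fin k) : RatField k := algebraMap (PolyRing k) (RatField k) (MvPolynomial.X (Sum.inr i))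

variable (k)

/-- `Ã_{2k} = ℂ[x_i^{±1}, y_i^{±1}]`, inside the field of rational functions. -/
def laurentRing : Subalgebra ℂ (RatField k) :=
  Algebra.adjoin ℂ (⋃ i : Fin k, {xVar i, (xVar i)⁻¹, yVar i, (yVar i)⁻¹})

variable {k}

/-- `x_i` in `Ã_{2k}`. -/
def xL (i : Fin k) : laurentRing k :=
  ⟨xVar i, Algebra.subset_adjoin (Set.mem_iUnion.2 ⟨i, by simp⟩)⟩

/-- `y_i` in `Ã_{2k}`. -/
def yL (i : Fin k) : laurentRing k :=
  ⟨yVar i, Algebra.subset_adjoin (Set.mem_iUnion.2 ⟨i, by simp⟩)⟩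

variable (k)

/-- The ideal `(∏ x_i y_i - 1)` of `Ã_{2k}`. -/
def shiftIdeal : Ideal (laurentRing k) := Ideal.span {∏ i, xL i * yL i - 1}

variable {k}

/-- `f` and `g` lie in `Ã_{2k}` and have the same image in `Ã_{2k} / (∏ x_i y_i - 1)`. -/
def SameImage (f g : RatField k) : Prop :=
  ∃ f' g' : laurentRing k, (f' : RatField k) = f ∧ (g' : RatField k) = g ∧
    Ideal.Quotient.mk (shiftIdeal k) f' = Ideal.Quotient.mk (shiftIdeal k) g'

/-- The linear map `φ_{2k}` with
`[φ_{2k}(∏ x_i^{β_i} y_i^{γ_i})]_n = ∏ α_{n+β_i} conj α_{n+γ_i}`. -/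
def phi (α : ℕ → ℂ) : PolyRing k →ₗ[ℂ] (ℕ → ℂ) :=
  (MvPolynomial.basisMonomials (Fin k ⊕ Fin k) ℂ).constr ℂ fun e n =>
    ∏ i, α (n + e (Sum.inl i)) * conj (α (n + e (Sum.inr i)))

/-- `P ∈ A_{2k}` represents the local polynomial `F`: `[φ_{2k}(P)]_n = F(α_n, …, α_{n+d})`. -/
def Represents {d : ℕ} (P : PolyRing k) (F : LocalPoly d) : Prop :=
  ∀ α : ℕ → ℂ, (∀ n, ‖α n‖ < 1) → ∀ n, phi α P n = localValue F α n

section GPrime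

variable {F : Type*} [Field F] (x y : Fin k → F)

/-- `a_{k,p} = ∏_{s=p}^{k} y_s ∏_{s=p+1}^{k} x_s`. -/
def aProd (p : Fin k) : F := (∏ s ∈ Finset.Ici p, y s) * ∏ s ∈ Finset.Ioi p, x s

/-- `b_{k,p} = ∏_{s=1}^{p} x_s y_s`. -/
def bProd (p : Fin k) : F := ∏ s ∈ Finset.Iic p, x s * y s

/-- The Hall–Littlewood type expression `G'_{2k}`, formed from `x_1, …, x_k` and `y_1, …, y_k`
in the given orders. -/
def gPrime [Algebra ℂ F] {K : ℕ} (θ : Fin K → ℝ) (m : Fin K → ℕ) : F :=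
  algebraMap ℂ F ((-1) ^ (k + 1) / ((k : ℂ) * (zH θ m : ℂ))) *
    (∑ p : Fin k, ∑ q : Fin k,
      hEval θ m (aProd x y p * bProd x y q) /
        ((∏ s ∈ Finset.univ.erase p, (1 - aProd x y s / aProd x y p)) *
          ∏ t ∈ Finset.univ.erase q, (bProd x y q / bProd x y t - 1)))
  - algebraMap ℂ F (1 / (k : ℂ))

end GPrime

end Algebra

end

end HigherOrderSumRule

/-! Conjugating `U_N` by the diagonal matrix of partial products of the `ρ_j` removes all square
roots. It becomes `S - T`, with `S` the lower shift and `T` having entries `α_{c-1} conj α_{c'}` on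
and above the subdiagonal (`semiconj_ggt`). A word of length `l` containing `k` letters `T` is, up
to rotation, a cyclic product of blocks `T S^{ν_s - 1}` with `ν` a composition of `l` into `k`
positive parts. Hence `Tr (S - T)^l` is the sum over `k` of `(-1)^k l / k` times a sum over such
cyclic products (`trace_sub_pow`). The word without `T` contributes nothing.

A block has rank-one entries `A_{c-1} B_{c'+ν_s-1}` subject to `c ≤ c' + ν_s`. Recording the slack
`μ_s` of each inequality turns a closed cycle into a weak composition `μ` of `l` together with a
translation `n` (`sum_cycles_eq`). Summing over translations gives, up to boundedly many edge terms
of bounded size, the sum of `φ` of the monomials `∏ a_p^{μ_p} ∏ b_q^{ν_q}`, where the `a_p` and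
`b_q` are exactly the products occurring in `G'_{2k}`. Their sum over `ν` and `μ` is a complete
symmetric function of the `a_p` times one of the `b_q` with all parts positive. Partial fractions
rewrite it as the double sum in `G'_{2k}` with `H(z)` replaced by `z^l` (`aeval_polyPos`). The
adjoint supplies the negative powers, up to a factor `w^{2l}` with `w = ∏ x_i y_i`
(`aeval_polyNeg`). The zeroth power contributes `1 / k`, because `Z_H = h_0`, and this cancels the
subtracted constant.

Multiplication by `w` shifts the index in `φ`, so a multiple of `w - 1` has telescoping, hence
bounded, partial sums. Translating each monomial until its least exponent is zero therefore yields
an admissible polynomial; its monomials fit into a window of length `d + 1` since their exponents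
spread by at most `l ≤ d` (`isTraceLocal_localTrace`).

Conversely, two admissible polynomials differ by one with bounded partial sums, and by scaling this
passes to homogeneous parts. Testing on periodic sequences shows that bounded partial sums force the
translated form of a polynomial to vanish as a function of the `α`'s (`phi_nrm_eq_zero`). Since `z`
and `conj z` are algebraically independent, its symmetrization vanishes
(`symm_eq_zero_of_phi_eq_zero`). So after symmetrization every representative is determined modulo
`w - 1`, which gives (ii). Correcting `polyMain` by an averaged difference gives (i). -/

namespace HigherOrderSumRule

noncomputable section

open scoped ComplexConjugate

/-! ### The weight on the circle: mean value and positivity. -/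

section Weight

variable {K : ℕ} (θ : Fin K → ℝ) (m : Fin K → ℕ)

/-- The point `e^{it}` as a unit of `ℂ`. -/
def circleUnit (t : ℝ) : ℂˣ := Units.mk0 (Complex.exp (t * Complex.I)) (Complex.exp_ne_zero _)

theorem circleUnit_zpow (t : ℝ) (n : ℤ) :
    (((circleUnit t) ^ n : ℂˣ) : ℂ) = Complex.exp ((n * Complex.I) * t) := by
  rw [Units.val_zpow_eq_zpow_val, circleUnit, Units.val_mk0, ← Complex.exp_int_mul]
  congr 1; ring

theorem eval₂_hPoly (t : ℝ) :
    LaurentPolynomial.eval₂ (RingHom.id ℂ) (circleUnit t) (hPoly θ m) =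
      ((∏ j, (1 - Real.cos (t - θ j)) ^ m j : ℝ) : ℂ) := by
  have h1 : ((circleUnit t : ℂˣ) : ℂ) = Complex.exp (t * Complex.I) := rfl
  have h2 : ((circleUnit t ^ (-1 : ℤ) : ℂˣ) : ℂ) = Complex.exp (-(t * Complex.I)) := by
    rw [circleUnit_zpow]; congr 1; push_cast; ring
  rw [hPoly, map_prod]
  push_cast
  refine Finset.prod_congr rfl fun j _ => ?_
  rw [map_pow, map_sub, map_one, map_add, LaurentPolynomial.eval₂_C_mul_T,
    LaurentPolynomial.eval₂_C_mul_T, h2, zpow_one, h1, Complex.cos]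
  simp only [RingHom.id_apply]
  rw [show ((t : ℂ) - θ j) * Complex.I = -(θ j * Complex.I) + t * Complex.I by ring,
    show -((t : ℂ) - θ j) * Complex.I = (θ j * Complex.I) + -(t * Complex.I) by ring,
    Complex.exp_add, Complex.exp_add]
  ring

theorem integral_eval₂ (p : LaurentPolynomial ℂ) :
    IntervalIntegrable (fun t : ℝ => LaurentPolynomial.eval₂ (RingHom.id ℂ) (circleUnit t) p)
      MeasureTheory.volume 0 (2 * Real.pi) ∧
    ∫ t in (0 : ℝ)..(2 * Real.pi), LaurentPolynomial.eval₂ (RingHom.id ℂ) (circleUnit t) p =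
      2 * Real.pi * p.coeff 0 := by
  induction p using LaurentPolynomial.induction_on' with
  | add p q hp hq =>
    simp only [map_add]
    refine ⟨hp.1.add hq.1, ?_⟩
    rw [intervalIntegral.integral_add hp.1 hq.1, hp.2, hq.2]
    simp [mul_add]
  | C_mul_T n a =>
    simp only [LaurentPolynomial.eval₂_C_mul_T, circleUnit_zpow, RingHom.id_apply]
    constructor
    · exact Continuous.intervalIntegrable (by fun_prop) _ _
    · rw [intervalIntegral.integral_const_mul, ← LaurentPolynomial.single_eq_C_mul_T]
      by_cases hn : n = 0
      · subst hn
        simp; ring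
      · have hc : (n : ℂ) * Complex.I ≠ 0 := by simp [hn]
        rw [integral_exp_mul_complex hc]
        have : Complex.exp ((n : ℂ) * Complex.I * ((2 * Real.pi : ℝ) : ℂ)) = 1 := by
          rw [show (n : ℂ) * Complex.I * ((2 * Real.pi : ℝ) : ℂ) = n * (2 * Real.pi * Complex.I) by
            push_cast; ring]
          exact Complex.exp_int_mul_two_pi_mul_I n
        rw [this, AddMonoidAlgebra.coeff_single, Finsupp.single_eq_of_ne' hn]
        simp

/-- This identity is what makes the constant term of `H` cancel the summand `-1/k` of `G'_{2k}`. -/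
theorem zH_eq_hCoeff_zero : (zH θ m : ℂ) = hCoeff θ m 0 := by
  have h := (integral_eval₂ (hPoly θ m)).2
  simp only [eval₂_hPoly] at h
  rw [intervalIntegral.integral_ofReal] at h
  rw [zH, hCoeff]
  push_cast
  rw [h]
  have : (Real.pi : ℂ) ≠ 0 := by exact_mod_cast Real.pi_ne_zero
  field_simp

theorem zH_pos (hθ : ∀ j, θ j ∈ Set.Ico 0 (2 * Real.pi)) : 0 < zH θ m := by
  have hpi := Real.pi_pos
  rw [zH]
  refine mul_pos (by positivity) ?_
  have hnn : ∀ t : ℝ, 0 ≤ ∏ j, (1 - Real.cos (t - θ j)) ^ m j := fun t =>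
    Finset.prod_nonneg fun j _ => pow_nonneg (by linarith [Real.cos_le_one (t - θ j)]) _
  refine intervalIntegral.integral_pos (by positivity)
    (Continuous.continuousOn (by fun_prop)) (fun t _ => hnn t) ?_
  -- On `[0, 2π)` the weight can vanish only at the finitely many `θ j`.
  obtain ⟨t, ht, hne⟩ : ∃ t ∈ Set.Ico 0 (2 * Real.pi), t ∉ Set.range θ := by
    by_contra! h
    exact (Set.Ico_infinite (by positivity : (0 : ℝ) < 2 * Real.pi))
      ((Set.finite_range θ).subset h)
  refine ⟨t, Set.Ico_subset_Icc_self ht, lt_of_le_of_ne (hnn t) (Ne.symm ?_)⟩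
  refine Finset.prod_ne_zero_iff.2 fun j _ => pow_ne_zero _ fun h => hne ⟨j, ?_⟩
  have h1 : Real.cos (t - θ j) = 1 := by linarith
  have := (Real.cos_eq_one_iff_of_lt_of_lt (by linarith [(hθ j).2, ht.1])
    (by linarith [(hθ j).1, ht.2])).1 h1
  linarith

end Weight

/-! ### Partial fractions for symmetric functions. -/

section PartialFractions

open PowerSeries

variable {ι F : Type*} [DecidableEq ι] [Field F]

theorem one_sub_mul_mk_pow (a : F) :
    (1 - C a * X) * PowerSeries.mk (fun n => a ^ n) = (1 : PowerSeries F) := by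
  ext n
  rw [sub_mul, one_mul, map_sub, mul_assoc, coeff_C_mul]
  cases n with
  | zero => simp
  | succ n => rw [coeff_succ_X_mul]; simp [pow_succ']

/-- The sum is the coefficient of degree `card - 1` in the Lagrange interpolant of the constant `1`.
-/
theorem sum_inv_prod_sub_eq_zero (s : Finset ι) (v : ι → F) (hv : Set.InjOn v s)
    (hs : 2 ≤ s.card) : ∑ p ∈ s, (∏ t ∈ s.erase p, (v p - v t))⁻¹ = 0 := by
  have h := Lagrange.coeff_eq_sum (P := (1 : Polynomial F)) hv (by
    rw [Polynomial.degree_one]; exact_mod_cast (by omega : 0 < s.card))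
  rw [Polynomial.coeff_one, if_neg (by omega)] at h
  rw [h]
  exact Finset.sum_congr rfl fun p _ => by simp

/-- This is the partial fraction expansion of `X^{n-1} / ∏ (1 - v_p X)`. In the induction one
multiplies by `1 - v_i X`: the constant terms cancel by `sum_inv_prod_sub_eq_zero`, and the factors
`v_p - v_i` that appear kill the term `p = i` and restore the weights of the smaller set. -/
theorem sum_inv_prod_sub_smul_mk_pow (s : Finset ι) (hs : s.Nonempty) (v : ι → F)
    (hv : Set.InjOn v s) :
    ∑ p ∈ s, C (∏ t ∈ s.erase p, (v p - v t))⁻¹ * PowerSeries.mk (fun n => v p ^ n) =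
      X ^ (s.card - 1) * ∏ p ∈ s, PowerSeries.mk (fun n => v p ^ n) := by
  induction hs using Finset.Nonempty.cons_induction with
  | singleton a => simp
  | cons i s hi hs ih =>
    have hinj : Set.InjOn v s := hv.mono (by simp)
    have hcard : 0 < s.card := hs.card_pos
    have hne : (1 - C (v i) * X : PowerSeries F) ≠ 0 := fun h => by
      have := one_sub_mul_mk_pow (v i)
      rw [h, zero_mul] at this
      exact zero_ne_one this
    apply mul_left_cancel₀ hne
    have hz := sum_inv_prod_sub_eq_zero (Finset.cons i s hi) v hv (by
      rw [Finset.card_cons]; omega)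
    have hterm : ∀ p ∈ s, ((∏ t ∈ (Finset.cons i s hi).erase p, (v p - v t))⁻¹) * (v p - v i) =
        (∏ t ∈ s.erase p, (v p - v t))⁻¹ := fun p hp => by
      have hpi : p ≠ i := fun h => hi (h ▸ hp)
      have hsub : v p - v i ≠ 0 := sub_ne_zero.2 fun h => hpi (hv (by simp [hp]) (by simp) h)
      rw [Finset.cons_eq_insert, Finset.erase_insert_of_ne hpi.symm,
        Finset.prod_insert (by simp [hi]), mul_inv]
      field_simp
    have hmk : ∀ p, (1 - C (v i) * X) * PowerSeries.mk (fun n => v p ^ n) =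
        1 + X * C (v p - v i) * PowerSeries.mk (fun n => v p ^ n) := fun p => by
      have := one_sub_mul_mk_pow (v p)
      rw [map_sub]
      linear_combination this
    calc (1 - C (v i) * X) * ∑ p ∈ Finset.cons i s hi,
          C (∏ t ∈ (Finset.cons i s hi).erase p, (v p - v t))⁻¹ * PowerSeries.mk (fun n => v p ^ n)
        = ∑ p ∈ Finset.cons i s hi, (C (∏ t ∈ (Finset.cons i s hi).erase p, (v p - v t))⁻¹ +
            X * (C ((∏ t ∈ (Finset.cons i s hi).erase p, (v p - v t))⁻¹ * (v p - v i)) *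
              PowerSeries.mk (fun n => v p ^ n))) := by
          rw [Finset.mul_sum]
          refine Finset.sum_congr rfl fun p _ => ?_
          rw [mul_left_comm, hmk, map_mul]
          ring
      _ = X * ∑ p ∈ s, C (∏ t ∈ s.erase p, (v p - v t))⁻¹ * PowerSeries.mk (fun n => v p ^ n) := by
          rw [Finset.sum_add_distrib, ← map_sum, hz, map_zero, zero_add, ← Finset.mul_sum,
            Finset.sum_cons, sub_self, mul_zero, map_zero, zero_mul, zero_add]
          congr 1
          exact Finset.sum_congr rfl fun p hp => by rw [hterm p hp]
      _ = _ := by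
          rw [ih hinj, Finset.card_cons, Finset.prod_cons, Nat.add_sub_cancel]
          obtain ⟨r, hr⟩ := Nat.exists_eq_succ_of_ne_zero hcard.ne'
          have h1 := one_sub_mul_mk_pow (v i)
          rw [hr, Nat.succ_sub_one, Nat.succ_eq_add_one, pow_succ]
          linear_combination (-(X ^ (r + 1)) * ∏ p ∈ s, PowerSeries.mk fun n => v p ^ n) * h1

variable {k : ℕ} (v : Fin k → F)

/-- The right side is the complete homogeneous symmetric function `h_l(v)`, read off as the
coefficient of degree `l + k - 1` in the partial fraction identity. -/
theorem sum_pow_div_prod_one_sub (hk : 0 < k) (hv : Function.Injective v) (h0 : ∀ i, v i ≠ 0)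
    (l : ℕ) :
    ∑ p, v p ^ l / ∏ s ∈ Finset.univ.erase p, (1 - v s / v p) =
      coeff l (∏ p, PowerSeries.mk (fun n => v p ^ n)) := by
  have : NeZero k := ⟨hk.ne'⟩
  have h := congrArg (coeff (l + (k - 1)))
    (sum_inv_prod_sub_smul_mk_pow Finset.univ Finset.univ_nonempty v hv.injOn)
  rw [Finset.card_univ, Fintype.card_fin, coeff_X_pow_mul, map_sum] at h
  rw [← h]
  refine Finset.sum_congr rfl fun p _ => ?_
  rw [coeff_C_mul, coeff_mk, pow_add, div_eq_mul_inv]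
  have : ∏ s ∈ Finset.univ.erase p, (v p - v s) =
      v p ^ (k - 1) * ∏ s ∈ Finset.univ.erase p, (1 - v s / v p) := by
    have hc : (Finset.univ.erase p).card = k - 1 := by simp
    rw [← hc, ← Finset.prod_const, ← Finset.prod_mul_distrib]
    refine Finset.prod_congr rfl fun s _ => ?_
    have := h0 p
    field_simp
  rw [this, mul_inv]
  have := pow_ne_zero (k - 1) (h0 p)
  field_simp

theorem mk_pos_pow (a : F) : PowerSeries.mk (fun n => if n = 0 then 0 else a ^ n) =
    C a * (X * PowerSeries.mk (fun n => a ^ n)) := by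
  ext n
  rw [coeff_C_mul, coeff_mk]
  cases n with
  | zero => simp
  | succ n => rw [coeff_succ_X_mul]; simp [pow_succ']

/-- The right side is `e_k h_{l-k}`, the sum of the monomials of degree `l` in which every variable
occurs. Positivity of `l` is essential: at `l = 0` the left side is `(-1)^{k-1}`. -/
theorem sum_pow_div_prod_sub_one (hk : 0 < k) (hv : Function.Injective v) (h0 : ∀ i, v i ≠ 0)
    {l : ℕ} (hl : 0 < l) :
    ∑ q, v q ^ l / ∏ t ∈ Finset.univ.erase q, (v q / v t - 1) =
      coeff l (∏ q, PowerSeries.mk (fun n => if n = 0 then 0 else v q ^ n)) := by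
  have : NeZero k := ⟨hk.ne'⟩
  have h := congrArg (coeff (l - 1))
    (sum_inv_prod_sub_smul_mk_pow Finset.univ Finset.univ_nonempty v hv.injOn)
  simp_rw [mk_pos_pow]
  rw [Finset.prod_mul_distrib, Finset.prod_mul_distrib, ← map_prod, coeff_C_mul, Finset.prod_const,
    Finset.card_univ, Fintype.card_fin]
  obtain ⟨l, rfl⟩ := Nat.exists_eq_succ_of_ne_zero hl.ne'
  obtain ⟨k, rfl⟩ := Nat.exists_eq_succ_of_ne_zero hk.ne'
  rw [pow_succ', mul_assoc, coeff_succ_X_mul]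
  rw [Finset.card_univ, Fintype.card_fin, Nat.succ_sub_one, Nat.succ_sub_one, map_sum] at h
  rw [← h, Finset.mul_sum]
  refine Finset.sum_congr rfl fun q _ => ?_
  rw [coeff_C_mul, coeff_mk, ← Finset.mul_prod_erase Finset.univ v (Finset.mem_univ q),
    div_eq_mul_inv]
  have : ∏ t ∈ Finset.univ.erase q, (v q - v t) =
      (∏ t ∈ Finset.univ.erase q, v t) * ∏ t ∈ Finset.univ.erase q, (v q / v t - 1) := by
    rw [← Finset.prod_mul_distrib]
    refine Finset.prod_congr rfl fun t _ => ?_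
    have := h0 t
    field_simp
  rw [this, mul_inv]
  have : ∏ t ∈ Finset.univ.erase q, v t ≠ 0 := Finset.prod_ne_zero_iff.2 fun t _ => h0 t
  field_simp
  rw [Nat.succ_eq_add_one, pow_succ']

end PartialFractions

/-! ### The power sums in `G'_{2k}` as sums of monomials. -/

section Polynomials

variable {k : ℕ}

/-- Sequences of `k` natural numbers with sum `l`. -/
def weakComps (k l : ℕ) : Finset (Fin k →₀ ℕ) := Finset.univ.finsuppAntidiag l

/-- Sequences of `k` positive integers with sum `l`. -/
def comps (k l : ℕ) : Finset (Fin k →₀ ℕ) := (weakComps k l).filter fun ν => ∀ i, ν i ≠ 0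

/-- Exponents of `∏ a_{k,p}^{μ_p} ∏ b_{k,q}^{ν_q}`. -/
def expPos (ν μ : Fin k →₀ ℕ) : Fin k ⊕ Fin k →₀ ℕ :=
  Finsupp.equivFunOnFinite.symm (Sum.elim
    (fun s => ∑ q ∈ Finset.Ici s, ν q + ∑ p ∈ Finset.Iio s, μ p)
    (fun s => ∑ q ∈ Finset.Ici s, ν q + ∑ p ∈ Finset.Iic s, μ p))

/-- Exponents of `∏ (w / a_{k,p})^{ν_p} ∏ (w / b_{k,q})^{μ_q}`, where `w = ∏ x_i y_i`. -/
def expNeg (ν μ : Fin k →₀ ℕ) : Fin k ⊕ Fin k →₀ ℕ :=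
  Finsupp.equivFunOnFinite.symm (Sum.elim
    (fun s => ∑ q ∈ Finset.Ici s, ν q + ∑ p ∈ Finset.Iio s, μ p)
    (fun s => ∑ q ∈ Finset.Ioi s, ν q + ∑ p ∈ Finset.Iio s, μ p))

/-- The polynomial `e_k(b) h_{l-k}(b) h_l(a)`. -/
def polyPos (k l : ℕ) : PolyRing k :=
  ∑ ν ∈ comps k l, ∑ μ ∈ weakComps k l, MvPolynomial.monomial (expPos ν μ) 1

/-- The polynomial `w^{2l} e_k(a⁻¹) h_{l-k}(a⁻¹) h_l(b⁻¹)`. -/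
def polyNeg (k l : ℕ) : PolyRing k :=
  ∑ ν ∈ comps k l, ∑ μ ∈ weakComps k l, MvPolynomial.monomial (expNeg ν μ) 1

theorem prod_prod_pow {R ι : Type*} [CommMonoid R] [Fintype ι] [DecidableEq ι] (I J : ι → Finset ι)
    (hIJ : ∀ p s, s ∈ I p ↔ p ∈ J s) (z : ι → R) (e : ι → ℕ) :
    ∏ p, (∏ s ∈ I p, z s) ^ e p = ∏ s, z s ^ (∑ p ∈ J s, e p) := by
  simp_rw [← Finset.prod_pow, ← Finset.prod_pow_eq_pow_sum]
  exact Finset.prod_comm' (by simp [hIJ])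

variable {F : Type*} [Field F] (x y : Fin k → F)

theorem aeval_monomial_one [Algebra ℂ F] (e : Fin k ⊕ Fin k →₀ ℕ) :
    MvPolynomial.aeval (Sum.elim x y) (MvPolynomial.monomial e (1 : ℂ)) =
      (∏ i, x i ^ e (Sum.inl i)) * ∏ i, y i ^ e (Sum.inr i) := by
  rw [MvPolynomial.aeval_monomial, map_one, one_mul, Finsupp.prod_fintype _ _ (by simp)]
  simp

theorem aeval_monomial_expPos [Algebra ℂ F] (ν μ : Fin k →₀ ℕ) :
    MvPolynomial.aeval (Sum.elim x y) (MvPolynomial.monomial (expPos ν μ) (1 : ℂ)) =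
      (∏ p, aProd x y p ^ μ p) * ∏ q, bProd x y q ^ ν q := by
  simp only [aProd, bProd, mul_pow, Finset.prod_mul_distrib]
  rw [prod_prod_pow Finset.Ici Finset.Iic (by simp), prod_prod_pow Finset.Ioi Finset.Iio (by simp),
    prod_prod_pow Finset.Iic Finset.Ici (by simp), prod_prod_pow Finset.Iic Finset.Ici (by simp),
    aeval_monomial_one]
  simp only [expPos, Finsupp.coe_equivFunOnFinite_symm, Sum.elim_inl, Sum.elim_inr, pow_add,
    Finset.prod_mul_distrib]
  ring

/-- `w / a_{k,p}`. -/
def aCompl (p : Fin k) : F := (∏ s ∈ Finset.Iic p, x s) * ∏ s ∈ Finset.Iio p, y s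

/-- `w / b_{k,q}`. -/
def bCompl (q : Fin k) : F := ∏ s ∈ Finset.Ioi q, x s * y s

theorem aProd_mul_aCompl (p : Fin k) : aProd x y p * aCompl x y p = ∏ i, x i * y i := by
  have hx : (∏ s ∈ Finset.Iic p, x s) * ∏ s ∈ Finset.Ioi p, x s = ∏ s, x s := by
    rw [← Finset.prod_union (Finset.disjoint_left.2 fun a => by simp)]
    congr 1; ext a; simp [le_or_gt]
  have hy : (∏ s ∈ Finset.Iio p, y s) * ∏ s ∈ Finset.Ici p, y s = ∏ s, y s := by
    rw [← Finset.prod_union (Finset.disjoint_left.2 fun a => by simp)]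
    congr 1; ext a; simp [lt_or_ge]
  rw [Finset.prod_mul_distrib, ← hx, ← hy, aProd, aCompl]
  ring

theorem bProd_mul_bCompl (q : Fin k) : bProd x y q * bCompl x y q = ∏ i, x i * y i := by
  rw [bProd, bCompl, ← Finset.prod_union (Finset.disjoint_left.2 fun a => by simp)]
  congr 1; ext a; simp [le_or_gt]

theorem aeval_monomial_expNeg [Algebra ℂ F] (ν μ : Fin k →₀ ℕ) :
    MvPolynomial.aeval (Sum.elim x y) (MvPolynomial.monomial (expNeg ν μ) (1 : ℂ)) =
      (∏ p, bCompl x y p ^ μ p) * ∏ q, aCompl x y q ^ ν q := by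
  simp only [aCompl, bCompl, mul_pow, Finset.prod_mul_distrib]
  rw [prod_prod_pow Finset.Ioi Finset.Iio (by simp), prod_prod_pow Finset.Ioi Finset.Iio (by simp),
    prod_prod_pow Finset.Iic Finset.Ici (by simp), prod_prod_pow Finset.Iio Finset.Ioi (by simp),
    aeval_monomial_one]
  simp only [expNeg, Finsupp.coe_equivFunOnFinite_symm, Sum.elim_inl, Sum.elim_inr, pow_add,
    Finset.prod_mul_distrib]
  ring

theorem sum_comps_mul (a b : Fin k → F) (l : ℕ) :
    ∑ ν ∈ comps k l, ∑ μ ∈ weakComps k l, (∏ p, a p ^ μ p) * ∏ q, b q ^ ν q =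
      PowerSeries.coeff l (∏ p, PowerSeries.mk (fun n => a p ^ n)) *
      PowerSeries.coeff l (∏ q, PowerSeries.mk (fun n => if n = 0 then 0 else b q ^ n)) := by
  rw [PowerSeries.coeff_prod, PowerSeries.coeff_prod]
  simp only [PowerSeries.coeff_mk]
  have : ∑ ν ∈ (Finset.univ : Finset (Fin k)).finsuppAntidiag l,
      ∏ q, (if ν q = 0 then 0 else b q ^ ν q) = ∑ ν ∈ comps k l, ∏ q, b q ^ ν q := by
    rw [comps, Finset.sum_filter]
    refine Finset.sum_congr rfl fun ν _ => ?_
    split_ifs with h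
    · exact Finset.prod_congr rfl fun q _ => if_neg (h q)
    · push Not at h
      obtain ⟨i, hi⟩ := h
      exact Finset.prod_eq_zero (Finset.mem_univ i) (if_pos hi)
  rw [this, mul_comm, Finset.sum_mul_sum]
  simp only [weakComps, mul_comm]

/-- The double sum in `G'_{2k}` with `H(z)` replaced by `z^l`. -/
def powerSum (l : ℤ) : F :=
  ∑ p : Fin k, ∑ q : Fin k, (aProd x y p * bProd x y q) ^ l /
    ((∏ s ∈ Finset.univ.erase p, (1 - aProd x y s / aProd x y p)) *
      ∏ t ∈ Finset.univ.erase q, (bProd x y q / bProd x y t - 1))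

theorem powerSum_eq_mul (l : ℤ) : powerSum x y l =
    (∑ p, aProd x y p ^ l / ∏ s ∈ Finset.univ.erase p, (1 - aProd x y s / aProd x y p)) *
    ∑ q, bProd x y q ^ l / ∏ t ∈ Finset.univ.erase q, (bProd x y q / bProd x y t - 1) := by
  rw [powerSum, Finset.sum_mul_sum]
  refine Finset.sum_congr rfl fun p _ => Finset.sum_congr rfl fun q _ => ?_
  rw [mul_zpow, div_mul_div_comm]

theorem prod_erase_neg (f : Fin k → F) (p : Fin k) :
    ∏ s ∈ Finset.univ.erase p, (-f s) = (-1) ^ (k - 1) * ∏ s ∈ Finset.univ.erase p, f s := by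
  rw [Finset.prod_neg]; simp

variable {x y}

theorem aProd_ne_zero (hx : ∀ i, x i ≠ 0) (hy : ∀ i, y i ≠ 0) (p : Fin k) : aProd x y p ≠ 0 :=
  mul_ne_zero (Finset.prod_ne_zero_iff.2 fun i _ => hy i)
    (Finset.prod_ne_zero_iff.2 fun i _ => hx i)

theorem bProd_ne_zero (hx : ∀ i, x i ≠ 0) (hy : ∀ i, y i ≠ 0) (q : Fin k) : bProd x y q ≠ 0 :=
  Finset.prod_ne_zero_iff.2 fun i _ => mul_ne_zero (hx i) (hy i)

theorem aCompl_eq (hx : ∀ i, x i ≠ 0) (hy : ∀ i, y i ≠ 0) (p : Fin k) :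
    aCompl x y p = (∏ i, x i * y i) * (aProd x y p)⁻¹ := by
  rw [← aProd_mul_aCompl x y p]
  have := aProd_ne_zero hx hy p
  field_simp

theorem bCompl_eq (hx : ∀ i, x i ≠ 0) (hy : ∀ i, y i ≠ 0) (q : Fin k) :
    bCompl x y q = (∏ i, x i * y i) * (bProd x y q)⁻¹ := by
  rw [← bProd_mul_bCompl x y q]
  have := bProd_ne_zero hx hy q
  field_simp

theorem aeval_polyPos [Algebra ℂ F] (hk : 0 < k) (ha : Function.Injective (aProd x y))
    (hb : Function.Injective (bProd x y)) (hx : ∀ i, x i ≠ 0) (hy : ∀ i, y i ≠ 0) {l : ℕ}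
    (hl : 0 < l) :
    MvPolynomial.aeval (Sum.elim x y) (polyPos k l) = powerSum x y l := by
  rw [powerSum_eq_mul]
  simp only [zpow_natCast]
  rw [sum_pow_div_prod_one_sub _ hk ha (aProd_ne_zero hx hy),
    sum_pow_div_prod_sub_one _ hk hb (bProd_ne_zero hx hy) hl, ← sum_comps_mul, polyPos]
  simp only [map_sum, aeval_monomial_expPos]

theorem mem_weakComps {l : ℕ} {μ : Fin k →₀ ℕ} : μ ∈ weakComps k l ↔ ∑ i, μ i = l := by
  simp [weakComps, Finset.mem_finsuppAntidiag]

theorem mem_comps {l : ℕ} {μ : Fin k →₀ ℕ} :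
    μ ∈ comps k l ↔ ∑ i, μ i = l ∧ ∀ i, μ i ≠ 0 := by
  rw [comps, Finset.mem_filter, mem_weakComps]

/-- Replacing all `a_p` and `b_q` by their inverses exchanges the two kinds of denominator, each at
the cost of a sign `(-1)^{k-1}`. The two signs cancel, and `a` and `b` trade roles: now the
exponents of the `a_q⁻¹` are the positive ones. -/
theorem powerSum_neg_natCast (hk : 0 < k) (ha : Function.Injective (aProd x y))
    (hb : Function.Injective (bProd x y)) (hx : ∀ i, x i ≠ 0) (hy : ∀ i, y i ≠ 0) {l : ℕ}
    (hl : 0 < l) :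
    powerSum x y (-l) = ∑ ν ∈ comps k l, ∑ μ ∈ weakComps k l,
      (∏ p, (bProd x y p)⁻¹ ^ μ p) * ∏ q, (aProd x y q)⁻¹ ^ ν q := by
  have ha0 := aProd_ne_zero hx hy
  have hb0 := bProd_ne_zero hx hy
  rw [sum_comps_mul, ← sum_pow_div_prod_one_sub (fun p => (bProd x y p)⁻¹) hk
    (inv_injective.comp hb) (fun i => inv_ne_zero (hb0 i)), ← sum_pow_div_prod_sub_one (fun p => (aProd x y p)⁻¹) hk (inv_injective.comp ha)
    (fun i => inv_ne_zero (ha0 i)) hl, powerSum_eq_mul]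
  have h1 : ∀ p, ∏ s ∈ Finset.univ.erase p, (1 - aProd x y s / aProd x y p) =
      (-1) ^ (k - 1) * ∏ s ∈ Finset.univ.erase p, ((aProd x y p)⁻¹ / (aProd x y s)⁻¹ - 1) :=
    fun p => by
      rw [← prod_erase_neg]
      exact Finset.prod_congr rfl fun s _ => by rw [inv_div_inv]; ring
  have h2 : ∀ p, ∏ s ∈ Finset.univ.erase p, (bProd x y p / bProd x y s - 1) =
      (-1) ^ (k - 1) * ∏ s ∈ Finset.univ.erase p, (1 - (bProd x y s)⁻¹ / (bProd x y p)⁻¹) :=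
    fun p => by
      rw [← prod_erase_neg]
      exact Finset.prod_congr rfl fun s _ => by rw [inv_div_inv]; ring
  have hsq : ((-1 : F) ^ (k - 1))⁻¹ * ((-1 : F) ^ (k - 1))⁻¹ = 1 := by
    rw [← mul_inv, ← mul_pow]; simp
  simp only [h1, h2, zpow_neg, zpow_natCast, ← inv_pow]
  simp only [div_eq_mul_inv, mul_inv, mul_left_comm _ ((-1 : F) ^ (k - 1))⁻¹, ← Finset.mul_sum]
  linear_combination
    (∑ i, (aProd x y i)⁻¹ ^ l *
      (∏ s ∈ Finset.univ.erase i, ((aProd x y i)⁻¹ * (aProd x y s)⁻¹⁻¹ - 1))⁻¹) *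
    (∑ i, (bProd x y i)⁻¹ ^ l *
      (∏ s ∈ Finset.univ.erase i, (1 - (bProd x y s)⁻¹ * (bProd x y i)⁻¹⁻¹))⁻¹) * hsq

theorem aeval_polyNeg [Algebra ℂ F] (hk : 0 < k) (ha : Function.Injective (aProd x y))
    (hb : Function.Injective (bProd x y)) (hx : ∀ i, x i ≠ 0) (hy : ∀ i, y i ≠ 0) {l : ℕ}
    (hl : 0 < l) :
    MvPolynomial.aeval (Sum.elim x y) (polyNeg k l) =
      (∏ i, x i * y i) ^ (2 * l) * powerSum x y (-l) := by
  rw [powerSum_neg_natCast hk ha hb hx hy hl, polyNeg, Finset.mul_sum]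
  simp only [map_sum, aeval_monomial_expNeg]
  refine Finset.sum_congr rfl fun ν hν => ?_
  rw [Finset.mul_sum]
  refine Finset.sum_congr rfl fun μ hμ => ?_
  simp only [aCompl_eq hx hy, bCompl_eq hx hy, mul_pow, Finset.prod_mul_distrib,
    Finset.prod_pow_eq_pow_sum]
  rw [mem_weakComps.1 hμ, (mem_comps.1 hν).1]
  ring

/-- Only the `b`-denominators are inverted here, so a single sign `(-1)^{k-1}` survives; both
remaining factors are `h_0 = 1`. -/
theorem powerSum_zero (hk : 0 < k) (ha : Function.Injective (aProd x y))
    (hb : Function.Injective (bProd x y)) (hx : ∀ i, x i ≠ 0) (hy : ∀ i, y i ≠ 0) :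
    powerSum x y 0 = (-1) ^ (k - 1) := by
  have ha0 := aProd_ne_zero hx hy
  have hb0 := bProd_ne_zero hx hy
  have key : ∀ v : Fin k → F, PowerSeries.coeff 0 (∏ p, PowerSeries.mk (fun n => v p ^ n)) = 1 :=
    fun v => by
      rw [PowerSeries.coeff_zero_eq_constantCoeff_apply, map_prod]
      exact Finset.prod_eq_one fun p _ => by
        rw [← PowerSeries.coeff_zero_eq_constantCoeff_apply, PowerSeries.coeff_mk, pow_zero]
  have e1 := sum_pow_div_prod_one_sub _ hk ha ha0 0
  have e2 := sum_pow_div_prod_one_sub _ hk (inv_injective.comp hb)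
    (fun i => inv_ne_zero (hb0 i)) 0
  rw [key] at e1 e2
  have h2 : ∀ p, ∏ s ∈ Finset.univ.erase p, (bProd x y p / bProd x y s - 1) =
      (-1) ^ (k - 1) * ∏ s ∈ Finset.univ.erase p, (1 - (bProd x y s)⁻¹ / (bProd x y p)⁻¹) :=
    fun p => by
      rw [← prod_erase_neg]
      exact Finset.prod_congr rfl fun s _ => by rw [inv_div_inv]; ring
  rw [powerSum_eq_mul]
  simp only [zpow_zero, pow_zero, Function.comp_def] at e1 e2 ⊢
  simp only [e1, h2, one_mul]
  simp only [one_div, mul_inv, ← Finset.mul_sum] at e2 ⊢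
  rw [e2, mul_one, ← inv_pow, inv_neg, inv_one]

theorem sum_Icc_neg_eq {M : Type*} [AddCommMonoid M] (d : ℕ) (f : ℤ → M) :
    ∑ l ∈ Finset.Icc (-(d : ℤ)) d, f l = f 0 + ∑ l ∈ Finset.Icc 1 d, (f l + f (-l)) := by
  induction d with
  | zero => simp
  | succ n ih =>
    rw [Finset.sum_Icc_succ_top (by omega), ← add_assoc, ← ih]
    have : Finset.Icc (-((n + 1 : ℕ) : ℤ)) ((n + 1 : ℕ) : ℤ) =
        insert ((n + 1 : ℕ) : ℤ) (insert (-((n + 1 : ℕ) : ℤ)) (Finset.Icc (-(n : ℤ)) n)) := by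
      ext a; simp only [Finset.mem_Icc, Finset.mem_insert]; omega
    rw [this, Finset.sum_insert (by simp only [Finset.mem_Icc, Finset.mem_insert]; omega),
      Finset.sum_insert (by simp only [Finset.mem_Icc]; omega)]
    abel

/-- The frequency `l = 0` contributes `(-1)^{k+1} (-1)^{k-1} h_0 / (k Z_H) = 1/k`, which is the
constant subtracted in `G'_{2k}`. -/
theorem gPrime_eq_sum_powerSum [Algebra ℂ F] (hk : 0 < k) (ha : Function.Injective (aProd x y))
    (hb : Function.Injective (bProd x y)) (hx : ∀ i, x i ≠ 0) (hy : ∀ i, y i ≠ 0)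
    {K : ℕ} (θ : Fin K → ℝ) (m : Fin K → ℕ) (hZ : zH θ m ≠ 0) :
    gPrime x y θ m = algebraMap ℂ F ((-1) ^ (k + 1) / ((k : ℂ) * (zH θ m : ℂ))) *
      ∑ l ∈ Finset.Icc 1 (order m), (algebraMap ℂ F (hCoeff θ m l) * powerSum x y l +
        algebraMap ℂ F (hCoeff θ m (-l)) * powerSum x y (-l)) := by
  have h1 : (∑ p : Fin k, ∑ q : Fin k,
      hEval θ m (aProd x y p * bProd x y q) /
        ((∏ s ∈ Finset.univ.erase p, (1 - aProd x y s / aProd x y p)) *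
          ∏ t ∈ Finset.univ.erase q, (bProd x y q / bProd x y t - 1))) =
      ∑ l ∈ Finset.Icc (-(order m : ℤ)) (order m),
        algebraMap ℂ F (hCoeff θ m l) * powerSum x y l := by
    simp only [powerSum, Finset.mul_sum, hEval, Finset.sum_div]
    rw [Finset.sum_comm]
    conv_rhs => rw [Finset.sum_comm]
    rw [Finset.sum_comm]
    refine Finset.sum_congr rfl fun p _ => ?_
    conv_rhs => rw [Finset.sum_comm]
    exact Finset.sum_congr rfl fun q _ => Finset.sum_congr rfl fun l _ => mul_div_assoc _ _ _
  rw [gPrime, h1, sum_Icc_neg_eq, mul_add, powerSum_zero hk ha hb hx hy, ← zH_eq_hCoeff_zero]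
  have h2 : algebraMap ℂ F ((-1) ^ (k + 1) / ((k : ℂ) * (zH θ m : ℂ))) *
      (algebraMap ℂ F (zH θ m : ℂ) * (-1) ^ (k - 1)) = algebraMap ℂ F (1 / (k : ℂ)) := by
    have : ((-1 : F)) ^ (k - 1) = algebraMap ℂ F ((-1) ^ (k - 1)) := by simp
    rw [this, ← map_mul, ← map_mul]
    congr 1
    have hkc : (k : ℂ) ≠ 0 := by exact_mod_cast hk.ne'
    have hZc : (zH θ m : ℂ) ≠ 0 := by exact_mod_cast hZ
    have : (-1 : ℂ) ^ (k + 1) * (-1) ^ (k - 1) = 1 := by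
      rw [← pow_add]; exact Even.neg_one_pow ⟨k, by omega⟩
    field_simp
    linear_combination this
  rw [h2]
  ring

end Polynomials

/-! ### Congruence modulo `w - 1` in the Laurent ring. -/

section SameImage

variable {k : ℕ}

/-- `w = ∏ x_i y_i`. -/
def wVar (k : ℕ) : RatField k := ∏ i : Fin k, xVar i * yVar i

theorem sameImage_iff {f g : RatField k} : SameImage f g ↔
    f ∈ laurentRing k ∧ g ∈ laurentRing k ∧ ∃ r ∈ laurentRing k, f - g = (wVar k - 1) * r := by
  have hw : (((∏ i, xL i * yL i - 1 : laurentRing k)) : RatField k) = wVar k - 1 := by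
    simp [wVar, xL, yL]
  constructor
  · rintro ⟨f', g', rfl, rfl, h⟩
    rw [Ideal.Quotient.eq, shiftIdeal, Ideal.mem_span_singleton] at h
    obtain ⟨r, hr⟩ := h
    refine ⟨f'.2, g'.2, r, r.2, ?_⟩
    rw [← hw, ← MulMemClass.coe_mul, ← hr]; rfl
  · rintro ⟨hf, hg, r, hr, h⟩
    refine ⟨⟨f, hf⟩, ⟨g, hg⟩, rfl, rfl, ?_⟩
    rw [Ideal.Quotient.eq, shiftIdeal, Ideal.mem_span_singleton]
    refine ⟨⟨r, hr⟩, Subtype.ext ?_⟩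
    rw [MulMemClass.coe_mul, hw]
    exact h

theorem SameImage.refl {f : RatField k} (hf : f ∈ laurentRing k) : SameImage f f :=
  sameImage_iff.2 ⟨hf, hf, 0, zero_mem _, by simp⟩

theorem SameImage.add {f g f' g' : RatField k} (h : SameImage f g) (h' : SameImage f' g') :
    SameImage (f + f') (g + g') := by
  rw [sameImage_iff] at *
  obtain ⟨hf, hg, r, hr, e⟩ := h
  obtain ⟨hf', hg', r', hr', e'⟩ := h'
  exact ⟨add_mem hf hf', add_mem hg hg', r + r', add_mem hr hr', by linear_combination e + e'⟩

theorem SameImage.mul_left {f g c : RatField k} (hc : c ∈ laurentRing k) (h : SameImage f g) :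
    SameImage (c * f) (c * g) := by
  rw [sameImage_iff] at *
  obtain ⟨hf, hg, r, hr, e⟩ := h
  exact ⟨mul_mem hc hf, mul_mem hc hg, c * r, mul_mem hc hr, by linear_combination c * e⟩

theorem SameImage.sum {ι : Type*} (s : Finset ι) {f g : ι → RatField k}
    (h : ∀ i ∈ s, SameImage (f i) (g i)) : SameImage (∑ i ∈ s, f i) (∑ i ∈ s, g i) := by
  classical
  induction s using Finset.induction_on with
  | empty => simpa using SameImage.refl (zero_mem _)
  | insert i s hi ih =>
    rw [Finset.sum_insert hi, Finset.sum_insert hi]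
    exact (h i (Finset.mem_insert_self i s)).add
      (ih fun j hj => h j (Finset.mem_insert_of_mem hj))

theorem xVar_ne_zero (i : Fin k) : xVar i ≠ 0 := by
  rw [xVar, Ne, IsFractionRing.to_map_eq_zero_iff]
  exact MvPolynomial.X_ne_zero _

theorem yVar_ne_zero (i : Fin k) : yVar i ≠ 0 := by
  rw [yVar, Ne, IsFractionRing.to_map_eq_zero_iff]
  exact MvPolynomial.X_ne_zero _

theorem algebraMap_mem_laurentRing (P : PolyRing k) :
    algebraMap (PolyRing k) (RatField k) P ∈ laurentRing k := by
  induction P using MvPolynomial.induction_on with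
  | C a =>
    have : algebraMap (PolyRing k) (RatField k) (MvPolynomial.C a) =
        algebraMap ℂ (RatField k) a := by
      rw [IsScalarTower.algebraMap_apply ℂ (PolyRing k) (RatField k), MvPolynomial.algebraMap_eq]
    rw [this]
    exact (laurentRing k).algebraMap_mem a
  | add p q hp hq => rw [map_add]; exact add_mem hp hq
  | mul_X p i hp =>
    rw [map_mul]
    refine mul_mem hp ?_
    cases i with
    | inl i => exact (xL i).2
    | inr i => exact (yL i).2

theorem wVar_eq_algebraMap : wVar k = algebraMap (PolyRing k) (RatField k)
    (∏ i, MvPolynomial.X (Sum.inl i) * MvPolynomial.X (Sum.inr i)) := by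
  simp [wVar, xVar, yVar]

theorem wVar_inv_mem : (wVar k)⁻¹ ∈ laurentRing k := by
  rw [wVar, ← Finset.prod_inv_distrib]
  refine prod_mem fun i _ => ?_
  rw [mul_inv]
  refine mul_mem (Algebra.subset_adjoin (Set.mem_iUnion.2 ⟨i, by simp⟩))
    (Algebra.subset_adjoin (Set.mem_iUnion.2 ⟨i, by simp⟩))

theorem wVar_ne_zero : wVar k ≠ 0 :=
  Finset.prod_ne_zero_iff.2 fun i _ => mul_ne_zero (xVar_ne_zero i) (yVar_ne_zero i)

/-- `w` is a unit of the Laurent ring and is congruent to `1`. -/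
theorem sameImage_wVar_pow_mul {f : RatField k} (n : ℕ)
    (h : wVar k ^ n * f ∈ laurentRing k) : SameImage (wVar k ^ n * f) f := by
  have hf : f ∈ laurentRing k := by
    have : f = (wVar k)⁻¹ ^ n * (wVar k ^ n * f) := by
      have := pow_ne_zero n (wVar_ne_zero (k := k))
      rw [inv_pow]; field_simp
    rw [this]
    exact mul_mem (pow_mem wVar_inv_mem n) h
  have hw : wVar k ∈ laurentRing k := by
    rw [wVar_eq_algebraMap]; exact algebraMap_mem_laurentRing _
  refine sameImage_iff.2 ⟨h, hf, (∑ i ∈ Finset.range n, wVar k ^ i) * f,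
    mul_mem (sum_mem fun i _ => pow_mem hw i) hf, ?_⟩
  rw [← mul_assoc, mul_geom_sum]
  ring

theorem algebraMap_rename (σ τ : Equiv.Perm (Fin k)) (P : PolyRing k) :
    algebraMap (PolyRing k) (RatField k) (MvPolynomial.rename (Sum.map σ τ) P) =
      MvPolynomial.aeval (Sum.elim (fun i => xVar (σ i)) (fun i => yVar (τ i))) P := by
  have : (IsScalarTower.toAlgHom ℂ (PolyRing k) (RatField k)).comp
      (MvPolynomial.rename (Sum.map σ τ)) =
      MvPolynomial.aeval (Sum.elim (fun i => xVar (σ i)) (fun i => yVar (τ i))) := by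
    ext i
    cases i <;> simp [xVar, yVar]
  exact DFunLike.congr_fun this P

theorem prod_xVar_mul_yVar_perm (σ τ : Equiv.Perm (Fin k)) :
    ∏ i, xVar (σ i) * yVar (τ i) = wVar k := by
  rw [wVar, Finset.prod_mul_distrib, Finset.prod_mul_distrib, Equiv.prod_comp σ xVar,
    Equiv.prod_comp τ yVar]

theorem injective_of_eval {ι : Type*} [LinearOrder ι] (f : ι → PolyRing k)
    (h : ∀ p q, p < q → ∃ z, MvPolynomial.eval z (f p) ≠ MvPolynomial.eval z (f q)) :
    Function.Injective fun i => algebraMap (PolyRing k) (RatField k) (f i) := by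
  intro p q hpq
  have e : f p = f q := IsFractionRing.injective (PolyRing k) (RatField k) hpq
  rcases lt_trichotomy p q with hlt | rfl | hlt
  · obtain ⟨z, hz⟩ := h p q hlt
    exact absurd (by rw [e]) hz
  · rfl
  · obtain ⟨z, hz⟩ := h q p hlt
    exact absurd (by rw [e]) hz

theorem injective_aProd_perm (σ τ : Equiv.Perm (Fin k)) :
    Function.Injective (aProd (fun i => xVar (σ i)) (fun i => yVar (τ i))) := by
  have : aProd (fun i => xVar (σ i)) (fun i => yVar (τ i)) = fun p =>
      algebraMap (PolyRing k) (RatField k)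
        ((∏ s ∈ Finset.Ici p, MvPolynomial.X (Sum.inr (τ s))) *
          ∏ s ∈ Finset.Ioi p, MvPolynomial.X (Sum.inl (σ s))) := by
    ext p; simp [aProd, xVar, yVar]
  rw [this]
  -- Setting `y_{τ p} = 0` and all other variables to `1` kills `a_p` but not `a_q` for `q > p`.
  refine injective_of_eval _ fun p q hpq =>
    ⟨Sum.elim (fun _ => 1) (fun s => if s = τ p then 0 else 1), ?_⟩
  simp only [map_mul, map_prod, MvPolynomial.eval_X, Sum.elim_inl, Sum.elim_inr,
    Finset.prod_const_one, mul_one, EmbeddingLike.apply_eq_iff_eq]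
  have h0 : ∏ s ∈ Finset.Ici p, (if s = p then (0 : ℂ) else 1) = 0 :=
    Finset.prod_eq_zero (Finset.mem_Ici.2 le_rfl) (if_pos rfl)
  rw [h0, Finset.prod_eq_one]
  · exact zero_ne_one
  · intro s hs
    exact if_neg (hpq.trans_le (Finset.mem_Ici.1 hs)).ne'

theorem injective_bProd_perm (σ τ : Equiv.Perm (Fin k)) :
    Function.Injective (bProd (fun i => xVar (σ i)) (fun i => yVar (τ i))) := by
  have : bProd (fun i => xVar (σ i)) (fun i => yVar (τ i)) = fun p =>
      algebraMap (PolyRing k) (RatField k)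
        (∏ s ∈ Finset.Iic p, MvPolynomial.X (Sum.inl (σ s)) * MvPolynomial.X (Sum.inr (τ s))) := by
    ext p; simp [bProd, xVar, yVar]
  rw [this]
  -- Here `y_{τ q} = 0` kills `b_q` but not `b_p` for `p < q`.
  refine injective_of_eval _ fun p q hpq =>
    ⟨Sum.elim (fun _ => 1) (fun s => if s = τ q then 0 else 1), ?_⟩
  simp only [map_mul, map_prod, MvPolynomial.eval_X, Sum.elim_inl, Sum.elim_inr, one_mul,
    EmbeddingLike.apply_eq_iff_eq]
  have h0 : ∏ s ∈ Finset.Iic q, (if s = q then (0 : ℂ) else 1) = 0 :=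
    Finset.prod_eq_zero (Finset.mem_Iic.2 le_rfl) (if_pos rfl)
  rw [h0, Finset.prod_eq_one]
  · exact one_ne_zero
  · intro s hs
    exact if_neg ((Finset.mem_Iic.1 hs).trans_lt hpq).ne

variable {K : ℕ} (θ : Fin K → ℝ) (m : Fin K → ℕ)

/-- A polynomial with the same image as `G'_{2k}`. -/
def polyMain (k : ℕ) : PolyRing k :=
  ((-1) ^ (k + 1) / ((k : ℂ) * (zH θ m : ℂ))) • ∑ l ∈ Finset.Icc 1 (order m),
    (hCoeff θ m l • polyPos k l + hCoeff θ m (-l) • polyNeg k l)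

/-- The positive frequencies agree exactly, and the negative ones up to the factor `w^{2l}`, which
is invisible modulo `w - 1`. Permuting the variables leaves `w` fixed, so all orders are handled at
once. -/
theorem sameImage_polyMain (hk : 0 < k) (hZ : zH θ m ≠ 0) (σ τ : Equiv.Perm (Fin k)) :
    SameImage (algebraMap (PolyRing k) (RatField k)
        (MvPolynomial.rename (Sum.map σ τ) (polyMain θ m k)))
      (gPrime (fun i => xVar (σ i)) (fun i => yVar (τ i)) θ m) := by
  have ha := injective_aProd_perm σ τ
  have hb := injective_bProd_perm σ τ
  have hx : ∀ i, xVar (σ i) ≠ 0 := fun i => xVar_ne_zero _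
  have hy : ∀ i, yVar (τ i) ≠ 0 := fun i => yVar_ne_zero _
  rw [gPrime_eq_sum_powerSum hk ha hb hx hy θ m hZ, algebraMap_rename, polyMain]
  simp only [map_smul, map_sum, map_add]
  simp only [Algebra.smul_def]
  have hc : ∀ c : ℂ, algebraMap ℂ (RatField k) c ∈ laurentRing k :=
    (laurentRing k).algebraMap_mem
  refine SameImage.mul_left (hc _) (SameImage.sum _ fun l hl => ?_)
  have hl0 : 0 < l := (Finset.mem_Icc.1 hl).1
  refine (SameImage.mul_left (hc _) ?_).add (SameImage.mul_left (hc _) ?_)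
  · rw [← aeval_polyPos hk ha hb hx hy hl0, ← algebraMap_rename]
    exact SameImage.refl (algebraMap_mem_laurentRing _)
  · have h := aeval_polyNeg hk ha hb hx hy hl0
    rw [prod_xVar_mul_yVar_perm] at h
    rw [h]
    refine sameImage_wVar_pow_mul _ ?_
    rw [← h, ← algebraMap_rename]
    exact algebraMap_mem_laurentRing _

end SameImage

/-! ### Expansion of `Tr (S - T)^l` by the number of letters `T`. -/

section TraceExpansion

open Polynomial

variable {ι : Type*} [Fintype ι] [DecidableEq ι]

theorem map_derivative_mul {ι R : Type*} [Fintype ι] [CommRing R] (M N : Matrix ι ι R[X]) :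
    (M * N).map derivative = M.map derivative * N + M * N.map derivative := by
  ext1 i j
  simp only [Matrix.map_apply, Matrix.mul_apply, Matrix.add_apply, map_sum, derivative_mul,
    Finset.sum_add_distrib]

/-- Cyclicity of the trace gives `(Tr M^l)' = l Tr(M^{l-1} M')`. The commuting factor `N` is carried
along so that the induction can absorb a power of `M`. -/
theorem trace_mul_map_derivative_pow {R : Type*} [CommRing R] (M : Matrix ι ι R[X]) (l : ℕ) :
    ∀ N : Matrix ι ι R[X], Commute N M →
      (N * (M ^ l).map derivative).trace = l * (N * M ^ (l - 1) * M.map derivative).trace := by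
  induction l with
  | zero =>
    intro N _
    have : (1 : Matrix ι ι R[X]).map derivative = 0 := by
      ext1 i j; by_cases h : i = j <;> simp [h]
    simp [this]
  | succ l ih =>
    intro N hN
    rw [pow_succ, map_derivative_mul, mul_add, Matrix.trace_add, ← mul_assoc,
      Matrix.trace_mul_comm, ← mul_assoc, ih (M * N) ((Commute.refl M).mul_left hN),
      Nat.add_sub_cancel, ← mul_assoc]
    have : (l : R[X]) * (M * N * M ^ (l - 1) * M.map derivative).trace =
        l * (N * M ^ l * M.map derivative).trace := by
      rcases l with _ | l
      · simp
      · rw [Nat.add_sub_cancel, ← hN.eq, mul_assoc N M, ← pow_succ']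
    rw [this]
    push_cast
    ring

variable (S T : Matrix ι ι ℂ)

/-- The matrix `S + t T` over `ℂ[t]`. -/
def pencil : Matrix ι ι ℂ[X] := S.map C + (X : ℂ[X]) • T.map C

/-- The matrix `∑_{n ≥ 1} z^n T S^{n-1}` over `ℂ⟦z⟧`. -/
def returnSeries : Matrix ι ι (PowerSeries ℂ) :=
  Matrix.of fun a b => PowerSeries.mk fun n => if n = 0 then 0 else (T * S ^ (n - 1)) a b

theorem add_smul_pow {R A : Type*} [CommSemiring R] [Semiring A] [Algebra R A] (x : R) (a b : A)
    (n : ℕ) : (a + x • b) ^ n = a ^ n +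
      x • ∑ i ∈ Finset.range n, a ^ i * (b * (a + x • b) ^ (n - 1 - i)) := by
  induction n with
  | zero => simp
  | succ n ih =>
    rw [Finset.sum_range_succ', Nat.add_sub_cancel, pow_zero, one_mul, Nat.sub_zero, smul_add,
      ← add_assoc, pow_succ', add_mul, smul_mul_assoc]
    congr 1
    nth_rewrite 1 [ih]
    rw [mul_add, pow_succ', mul_smul_comm, Finset.mul_sum]
    congr 2
    refine Finset.sum_congr rfl fun i _ => ?_
    rw [pow_succ', mul_assoc, Nat.sub_sub, add_comm 1 i]

theorem pencil_pow (n : ℕ) : pencil S T ^ n = S.map C ^ n +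
    (X : ℂ[X]) • ∑ i ∈ Finset.range n, S.map C ^ i * (T.map C * pencil S T ^ (n - 1 - i)) :=
  add_smul_pow _ _ _ n

theorem map_C_mul_pow (j : ℕ) : T.map C * S.map C ^ j = (T * S ^ j).map (C : ℂ →+* ℂ[X]) := by
  rw [Matrix.map_mul, Matrix.map_pow]

theorem constantCoeff_returnSeries_pow (k : ℕ) (a b : ι) :
    PowerSeries.coeff 0 ((returnSeries S T ^ (k + 1)) a b) = 0 := by
  rw [pow_succ', Matrix.mul_apply, map_sum]
  refine Finset.sum_eq_zero fun c _ => ?_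
  rw [PowerSeries.coeff_zero_eq_constantCoeff_apply, map_mul]
  simp [returnSeries]

/-- A word that begins with `T` and contains `k` further letters `T` is cut in front of each `T`
into `k + 1` blocks `T S^{j-1}` of total length `n + 1`. -/
theorem coeff_mul_pencil_pow (k : ℕ) : ∀ (n : ℕ) (a b : ι),
    ((T.map C * pencil S T ^ n) a b).coeff k =
      PowerSeries.coeff (n + 1) ((returnSeries S T ^ (k + 1)) a b) := by
  induction k with
  | zero =>
    intro n a b
    rw [pencil_pow, mul_add, map_C_mul_pow, mul_smul_comm, zero_add, pow_one, Matrix.add_apply,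
      Matrix.smul_apply, smul_eq_mul, coeff_add, coeff_X_mul_zero, add_zero, Matrix.map_apply,
      coeff_C_zero]
    simp [returnSeries]
  | succ k ih =>
    intro n a b
    rw [pencil_pow, mul_add, map_C_mul_pow, mul_smul_comm, Matrix.add_apply,
      Matrix.smul_apply, smul_eq_mul, coeff_add, coeff_X_mul, Matrix.map_apply,
      coeff_C_succ, zero_add, Finset.mul_sum, pow_succ' (returnSeries S T) (k + 1)]
    simp only [← mul_assoc (T.map C) (Matrix.map S C ^ _), map_C_mul_pow]
    rw [Matrix.sum_apply, finsetSum_coeff, Matrix.mul_apply, map_sum]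
    simp only [PowerSeries.coeff_mul, Finset.Nat.sum_antidiagonal_succ]
    have hterm : ∀ i j, (((T * S ^ i).map C * (T.map C * pencil S T ^ j)) a b).coeff k =
        ∑ c, (T * S ^ i) a c * PowerSeries.coeff (j + 1) ((returnSeries S T ^ (k + 1)) c b) :=
      fun i j => by
        rw [Matrix.mul_apply, finsetSum_coeff]
        exact Finset.sum_congr rfl fun c _ => by rw [Matrix.map_apply, coeff_C_mul, ih]
    simp only [hterm]
    rw [Finset.sum_comm]
    refine Finset.sum_congr rfl fun c _ => ?_
    rw [Finset.Nat.sum_antidiagonal_eq_sum_range_succ_mk, Finset.sum_range_succ, Nat.sub_self,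
      constantCoeff_returnSeries_pow, mul_zero, add_zero]
    have h0 : PowerSeries.coeff 0 (returnSeries S T a c) = 0 := by simp [returnSeries]
    rw [h0, zero_mul, zero_add]
    refine Finset.sum_congr rfl fun i hi => ?_
    have hi' := Finset.mem_range.1 hi
    rw [show n - 1 - i + 1 = n - i by omega]
    simp [returnSeries]

theorem pow_apply_eq_sum_paths {R : Type*} [CommSemiring R] (M : Matrix ι ι R) (r : ℕ) :
    ∀ a b, (M ^ (r + 1)) a b =
      ∑ c : Fin r → ι, ∏ s : Fin (r + 1),
        M ((Fin.cons a c : Fin (r + 1) → ι) s) ((Fin.snoc c b : Fin (r + 1) → ι) s) := by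
  induction r with
  | zero => intro a b; simp [Fin.snoc]
  | succ r ih =>
    intro a b
    rw [pow_succ', Matrix.mul_apply, ← (Fin.consEquiv fun _ => ι).sum_comp, Fintype.sum_prod_type]
    refine Finset.sum_congr rfl fun e _ => ?_
    rw [ih, Finset.mul_sum]
    refine Finset.sum_congr rfl fun c _ => ?_
    rw [Fin.prod_univ_succ (n := r + 1)]
    have h : ∀ s, (Fin.snoc ((Fin.consEquiv fun _ => ι) (e, c)) b : Fin (r + 2) → ι) s =
        (Fin.cons e (Fin.snoc c b : Fin (r + 1) → ι) : Fin (r + 2) → ι) s := fun s => by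
      rw [Fin.cons_snoc_eq_snoc_cons]; rfl
    simp only [h, Fin.cons_zero, Fin.cons_succ]
    rfl

theorem trace_pow_eq_sum_cycles {R : Type*} [CommSemiring R] (M : Matrix ι ι R) (r : ℕ) :
    (M ^ (r + 1)).trace = ∑ f : Fin (r + 1) → ι, ∏ s, M (f s) (f (finRotate _ s)) := by
  rw [← (Fin.consEquiv fun _ => ι).sum_comp, Fintype.sum_prod_type, Matrix.trace]
  refine Finset.sum_congr rfl fun a _ => ?_
  rw [Matrix.diag_apply, pow_apply_eq_sum_paths]
  refine Finset.sum_congr rfl fun c _ => ?_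
  rw [Fin.snoc_eq_cons_rotate]
  rfl

theorem coeff_trace_returnSeries_pow (r l : ℕ) :
    PowerSeries.coeff l (returnSeries S T ^ (r + 1)).trace =
      ∑ ν ∈ comps (r + 1) l, ∑ f : Fin (r + 1) → ι,
        ∏ s, (T * S ^ (ν s - 1)) (f s) (f (finRotate _ s)) := by
  rw [trace_pow_eq_sum_cycles, map_sum]
  simp only [PowerSeries.coeff_prod]
  rw [Finset.sum_comm, comps, Finset.sum_filter, weakComps]
  refine Finset.sum_congr rfl fun ν _ => ?_
  split_ifs with h
  · refine Finset.sum_congr rfl fun f _ => Finset.prod_congr rfl fun s _ => ?_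
    rw [returnSeries, Matrix.of_apply, PowerSeries.coeff_mk, if_neg (h s)]
  · push Not at h
    obtain ⟨i, hi⟩ := h
    refine Finset.sum_eq_zero fun f _ => Finset.prod_eq_zero (Finset.mem_univ i) ?_
    rw [returnSeries, Matrix.of_apply, PowerSeries.coeff_mk, if_pos hi]

theorem comps_eq_empty {k l : ℕ} (h : l < k) : comps k l = ∅ := by
  refine Finset.eq_empty_of_forall_notMem fun ν hν => ?_
  rw [mem_comps] at hν
  have : ∑ i : Fin k, 1 ≤ ∑ i, ν i :=
    Finset.sum_le_sum fun i _ => Nat.one_le_iff_ne_zero.2 (hν.2 i)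
  simp at this
  omega

/-- Differentiating in `t` marks one letter `T`, and by cyclicity the word may be rotated to begin
with it. This is the source of the weight `l / k` of a cyclic word with `k` letters `T`. -/
theorem coeff_trace_pencil_pow {l : ℕ} (hl : 0 < l) (k : ℕ) :
    ((k : ℂ) + 1) * ((pencil S T ^ l).trace).coeff (k + 1) =
      l * PowerSeries.coeff l (returnSeries S T ^ (k + 1)).trace := by
  have hd : (pencil S T).map derivative = T.map C := by
    ext1 i j
    simp [pencil]
  have h := trace_mul_map_derivative_pow (pencil S T) l 1 (Commute.one_left _)
  rw [one_mul, one_mul, hd, Matrix.trace_mul_comm] at h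
  have h2 : ((pencil S T ^ l).map derivative).trace = derivative (pencil S T ^ l).trace := by
    simp [Matrix.trace, map_sum]
  rw [h2] at h
  have h3 := congrArg (fun p => p.coeff k) h
  simp only [coeff_derivative] at h3
  have h4 : (T.map C * pencil S T ^ (l - 1)).trace.coeff k =
      PowerSeries.coeff l (returnSeries S T ^ (k + 1)).trace := by
    rw [Matrix.trace, finsetSum_coeff, Matrix.trace, map_sum]
    refine Finset.sum_congr rfl fun a _ => ?_
    rw [Matrix.diag_apply, coeff_mul_pencil_pow, Nat.sub_add_cancel hl]
    rfl
  rw [← C_eq_natCast, coeff_C_mul, h4] at h3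
  rw [mul_comm, h3]

/-- Evaluate the trace of the pencil's power at `t = -1`. The constant coefficient is `Tr S^l = 0`,
and the degree is at most `l` because a composition of `l` has at most `l` positive parts. -/
theorem trace_sub_pow {l : ℕ} (hl : 0 < l) (hS : (S ^ l).trace = 0) :
    ((S - T) ^ l).trace = ∑ k ∈ Finset.range l, (-1) ^ (k + 1) * ((l : ℂ) / ((k : ℂ) + 1)) *
      ∑ ν ∈ comps (k + 1) l, ∑ f : Fin (k + 1) → ι,
        ∏ s, (T * S ^ (ν s - 1)) (f s) (f (finRotate _ s)) := by
  have hev : (S - T) = (pencil S T).map (evalRingHom (-1)) := by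
    ext1 i j
    simp [pencil, sub_eq_add_neg]
  have hev0 : S = (pencil S T).map (evalRingHom 0) := by
    ext1 i j
    simp [pencil]
  have htr : ∀ c : ℂ, (((pencil S T).map (evalRingHom c)) ^ l).trace =
      (pencil S T ^ l).trace.eval c := fun c => by
    rw [← Matrix.map_pow]
    simp [Matrix.trace, eval_finsetSum]
  have hk : ∀ k : ℕ, (k : ℂ) + 1 ≠ 0 := fun k => by exact_mod_cast k.succ_ne_zero
  have hcoeff : ∀ k, (pencil S T ^ l).trace.coeff (k + 1) = (l : ℂ) / ((k : ℂ) + 1) *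
      ∑ ν ∈ comps (k + 1) l, ∑ f : Fin (k + 1) → ι,
        ∏ s, (T * S ^ (ν s - 1)) (f s) (f (finRotate _ s)) := fun k => by
    rw [← coeff_trace_returnSeries_pow]
    have := coeff_trace_pencil_pow S T hl k
    field_simp [hk k]
    linear_combination this
  have hdeg : (pencil S T ^ l).trace.natDegree < l + 1 := by
    rw [Nat.lt_succ_iff, natDegree_le_iff_coeff_eq_zero]
    intro n hn
    obtain ⟨k, rfl⟩ := Nat.exists_eq_succ_of_ne_zero (by omega : n ≠ 0)
    rw [Nat.succ_eq_add_one, hcoeff, comps_eq_empty hn]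
    simp
  rw [hev, htr, eval_eq_sum_range' hdeg, Finset.sum_range_succ', coeff_zero_eq_eval_zero, ← htr,
    ← hev0, hS, zero_mul, add_zero]
  refine Finset.sum_congr rfl fun k _ => ?_
  rw [hcoeff]
  ring

end TraceExpansion

/-! ### Blocks formed from the shift and the Hessenberg matrix. -/

section Shift

variable {N : ℕ}

/-- The lower shift matrix. -/
def shiftMat (N : ℕ) : Matrix (Fin N) (Fin N) ℂ :=
  Matrix.of fun c c' => if (c : ℕ) = c' + 1 then 1 else 0

/-- The matrix with entries `A_{c-1} B_{c'}` for `c ≤ c' + 1`. -/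
def hessMat (A B : ℤ → ℂ) (N : ℕ) : Matrix (Fin N) (Fin N) ℂ :=
  Matrix.of fun c c' => if (c : ℕ) ≤ c' + 1 then A ((c : ℤ) - 1) * B c' else 0

theorem shiftMat_pow_apply (j : ℕ) (c c' : Fin N) :
    (shiftMat N ^ j) c c' = if (c : ℕ) = c' + j then 1 else 0 := by
  induction j generalizing c with
  | zero => simp [Matrix.one_apply, Fin.ext_iff]
  | succ j ih =>
    rw [pow_succ', Matrix.mul_apply]
    have hs : ∀ b : Fin N, shiftMat N c b = if (c : ℕ) = b + 1 then 1 else 0 := fun b => rfl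
    simp only [ih, hs, mul_ite, mul_one, mul_zero]
    by_cases h : (c : ℕ) = c' + (j + 1)
    · rw [if_pos h, Finset.sum_eq_single (⟨c' + j, by omega⟩ : Fin N)]
      · simp; omega
      · intro b _ hb
        rw [if_neg]
        intro hb'
        exact hb (Fin.ext hb')
      · simp
    · rw [if_neg h]
      refine Finset.sum_eq_zero fun b _ => ?_
      split_ifs <;> first | rfl | omega

theorem trace_shiftMat_pow {l : ℕ} (hl : 0 < l) : (shiftMat N ^ l).trace = 0 := by
  refine Finset.sum_eq_zero fun c _ => ?_
  rw [Matrix.diag_apply, shiftMat_pow_apply, if_neg (by omega)]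

/-- The power of the shift moves columns. Where a column is pushed past the edge the entry is zero,
and the vanishing of `B` beyond `N` makes the same formula valid there. -/
theorem hessMat_mul_shiftMat_pow (A B : ℤ → ℂ) (hB : ∀ n, B n ≠ 0 → n < N) {j : ℕ} (hj : j ≠ 0)
    (c c' : Fin N) : (hessMat A B N * shiftMat N ^ (j - 1)) c c' =
      if (c : ℕ) ≤ c' + j then A ((c : ℤ) - 1) * B ((c' : ℤ) + j - 1) else 0 := by
  rw [Matrix.mul_apply]
  simp only [shiftMat_pow_apply, mul_ite, mul_one, mul_zero]
  obtain ⟨j, rfl⟩ := Nat.exists_eq_succ_of_ne_zero hj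
  by_cases h : (c' : ℕ) + j < N
  · rw [Finset.sum_eq_single (⟨c' + j, h⟩ : Fin N)]
    · rw [hessMat, Matrix.of_apply, if_pos (by simp)]
      simp only [Nat.succ_eq_add_one, Nat.cast_add, Nat.cast_one, ← add_assoc, add_sub_cancel_right]
    · intro b _ hb
      rw [if_neg]
      intro hb'
      exact hb (Fin.ext hb')
    · simp
  · rw [Finset.sum_eq_zero fun b _ => if_neg (by omega)]
    have : B ((c' : ℤ) + (j.succ : ℕ) - 1) = 0 := by
      by_contra h'
      have := hB _ h'
      push_cast at this
      omega
    rw [this, mul_zero, ite_self]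

end Shift

/-! ### Closed cycles as translates of weak compositions. -/

section Cycles

variable {r N l : ℕ}

theorem apply_eq_of_finRotate {X : Type*} (D : Fin (r + 1) → X)
    (h : ∀ s, D (finRotate _ s) = D s) (s : Fin (r + 1)) : D s = D 0 := by
  induction s using Fin.induction with
  | zero => rfl
  | succ i ih => rw [← ih, ← h i.castSucc, finRotate_apply, Fin.coeSucc_eq_succ]

/-- A cycle `f` corresponds to the slacks `μ_s = f(s+1) + ν_s - f(s)`, which sum to `l` around the
cycle, and to one overall translation. The two relations between `u` and `v` say that `u` has the
same increments as `f`, so `f - u` is constant. The support of `A` discards exactly those translates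
that leave `{0, …, N-1}`. -/
theorem sum_cycles_eq (A B : ℤ → ℂ) (hA : ∀ n, A n ≠ 0 → -1 ≤ n ∧ n < (N : ℤ) - 1)
    (ν : Fin (r + 1) →₀ ℕ) (hν : ∑ i, ν i = l) (u v : (Fin (r + 1) →₀ ℕ) → Fin (r + 1) → ℕ)
    (huv : ∀ μ ∈ weakComps (r + 1) l, ∀ s, v μ s = u μ s + μ s)
    (hvu : ∀ μ ∈ weakComps (r + 1) l, ∀ s, v μ s = u μ (finRotate _ s) + ν s)
    (hu : ∀ μ ∈ weakComps (r + 1) l, ∀ s, u μ s ≤ 2 * l) :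
    ∑ f : Fin (r + 1) → Fin N, ∏ s,
      (if (f s : ℕ) ≤ f (finRotate _ s) + ν s then
        A ((f s : ℤ) - 1) * B ((f (finRotate _ s) : ℤ) + ν s - 1) else 0) =
    ∑ z ∈ weakComps (r + 1) l ×ˢ Finset.range (2 * l + 1 + N),
      ∏ s, A ((z.2 : ℤ) - (2 * l + 1 : ℕ) + u z.1 s) * B ((z.2 : ℤ) - (2 * l + 1 : ℕ) + v z.1 s) := by
  symm
  have hne : ∀ z : (Fin (r + 1) →₀ ℕ) × ℕ, (∏ s, A ((z.2 : ℤ) - (2 * l + 1 : ℕ) + u z.1 s) *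
      B ((z.2 : ℤ) - (2 * l + 1 : ℕ) + v z.1 s)) ≠ 0 → ∀ s,
      ((z.2 : ℤ) - (2 * l + 1 : ℕ) + u z.1 s + 1).toNat < N ∧
      0 ≤ (z.2 : ℤ) - (2 * l + 1 : ℕ) + u z.1 s + 1 := fun z hz s => by
    have := hA _ (left_ne_zero_of_mul (Finset.prod_ne_zero_iff.1 hz s (Finset.mem_univ s)))
    omega
  refine Finset.sum_bij_ne_zero (fun z _ hz s => ⟨_, (hne z hz s).1⟩) ?_ ?_ ?_ ?_
  · exact fun _ _ _ => Finset.mem_univ _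
  · rintro ⟨μ, n⟩ h1 h2 ⟨μ', n'⟩ h1' h2' heq
    have hm := (Finset.mem_product.1 h1).1
    have hm' := (Finset.mem_product.1 h1').1
    have key : ∀ s, (n : ℤ) + u μ s = n' + u μ' s := fun s => by
      have e := congrArg (fun f => ((f s : Fin N) : ℕ)) heq
      have := (hne _ h2 s).2
      have := (hne _ h2' s).2
      simp only at *
      omega
    have hμ : μ = μ' := by
      ext s
      have := key s
      have := key (finRotate _ s)
      have := huv μ hm s
      have := hvu μ hm s
      have := huv μ' hm' s
      have := hvu μ' hm' s
      omega
    subst hμ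
    have := key 0
    rw [Prod.mk.injEq]
    exact ⟨rfl, by omega⟩
  · intro f _ hf
    have hcond : ∀ s, (f s : ℕ) ≤ f (finRotate _ s) + ν s := fun s => by
      by_contra h
      exact hf (Finset.prod_eq_zero (Finset.mem_univ s) (if_neg h))
    let μ : Fin (r + 1) →₀ ℕ :=
      Finsupp.equivFunOnFinite.symm fun s => (f (finRotate _ s) : ℕ) + ν s - f s
    have hμ : ∀ s, f s + μ s = f (finRotate _ s) + ν s := fun s => by
      have := hcond s
      simp only [μ, Finsupp.coe_equivFunOnFinite_symm]
      omega
    have hm : μ ∈ weakComps (r + 1) l := by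
      rw [mem_weakComps]
      have h := Finset.sum_congr rfl fun (s : Fin (r + 1)) (_ : s ∈ Finset.univ) => hμ s
      rw [Finset.sum_add_distrib, Finset.sum_add_distrib,
        Equiv.sum_comp (finRotate (r + 1)) fun s => (f s : ℕ), hν] at h
      omega
    have hconst := apply_eq_of_finRotate (fun s => (f s : ℤ) - u μ s) fun s => by
      have := hμ s
      have := huv μ hm s
      have := hvu μ hm s
      omega
    have hu0 := hu μ hm 0
    -- The translation `f s - 1 - u μ s` can be as low as `-(2l + 1)`; the offset `2l + 1` makes it
    -- a natural number, and `u ≤ 2l` keeps the subtraction from truncating.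
    let n : ℕ := f 0 + 2 * l - u μ 0
    have hn : ∀ s, (n : ℤ) - (2 * l + 1 : ℕ) + u μ s + 1 = f s := fun s => by
      have := hconst s
      simp only [n] at *
      omega
    have hn' : ∀ s, (n : ℤ) - (2 * l + 1 : ℕ) + v μ s = (f (finRotate _ s) : ℤ) + ν s - 1 :=
      fun s => by
        have := hn s
        have := huv μ hm s
        have := hμ s
        omega
    refine ⟨(μ, n), Finset.mem_product.2 ⟨hm, Finset.mem_range.2 ?_⟩, ?_, ?_⟩
    · have := (f 0).2
      simp only [n]
      omega
    · refine fun h => hf ?_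
      rw [← h]
      refine Finset.prod_congr rfl fun s _ => ?_
      rw [if_pos (hcond s), hn', ← hn s, add_sub_cancel_right]
    · funext s
      refine Fin.ext ?_
      have := hn s
      simp only
      omega
  · rintro ⟨μ, n⟩ h1 h2
    have hm := (Finset.mem_product.1 h1).1
    refine Finset.prod_congr rfl fun s _ => ?_
    have e1 := (hne _ h2 s).2
    have e2 := (hne _ h2 (finRotate _ s)).2
    have := huv μ hm s
    have := hvu μ hm s
    simp only at *
    rw [if_pos (by omega), Int.toNat_of_nonneg e1, Int.toNat_of_nonneg e2, add_sub_cancel_right]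
    congr 2
    omega

/-- There are `L` terms of size at most `1` below zero, and at most `L` differences of size at most
`2` near the upper edge. -/
theorem norm_sum_range_sub_le (f : ℤ → ℂ) (g : ℕ → ℂ) (hf : ∀ n, ‖f n‖ ≤ 1) (hg : ∀ n, ‖g n‖ ≤ 1)
    (L : ℕ) (h : ∀ n : ℕ, n + L < N → f n = g n) :
    ‖∑ j ∈ Finset.range (L + N), f ((j : ℤ) - L) - ∑ j ∈ Finset.range N, g j‖ ≤ 3 * L := by
  have hcast : ∀ j : ℕ, (((L + j : ℕ) : ℤ) - L) = j := fun j => by push_cast; ring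
  rw [Finset.sum_range_add]
  simp only [hcast]
  rw [add_sub_assoc, ← Finset.sum_sub_distrib]
  have h1 : ‖∑ j ∈ Finset.range L, f ((j : ℤ) - L)‖ ≤ L := by
    refine (norm_sum_le_of_le _ fun j _ => hf _).trans ?_
    simp
  have h2 : ‖∑ j ∈ Finset.range N, (f j - g j)‖ ≤ 2 * L := by
    have : ∑ j ∈ Finset.range N, (f j - g j) = ∑ j ∈ Finset.Ico (N - L) N, (f j - g j) := by
      refine (Finset.sum_subset (fun j hj => ?_) fun j hj hj' => ?_).symm
      · simp only [Finset.mem_Ico, Finset.mem_range] at *; omega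
      · simp only [Finset.mem_Ico, Finset.mem_range] at *
        rw [h j (by omega), sub_self]
    rw [this]
    refine (norm_sum_le_of_le (f := fun j : ℕ => f j - g j) _ fun j _ =>
      (norm_sub_le (f j) (g j)).trans (add_le_add (hf j) (hg j))).trans ?_
    rw [Finset.sum_const, Nat.card_Ico, nsmul_eq_mul]
    have : ((N - (N - L) : ℕ) : ℝ) ≤ L := by exact_mod_cast (by omega : N - (N - L) ≤ L)
    linarith
  linarith [norm_add_le (∑ j ∈ Finset.range L, f ((j : ℤ) - L)) (∑ j ∈ Finset.range N, (f j - g j))]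

theorem norm_prod_le_one {ι : Type*} (s : Finset ι) (f : ι → ℂ) (h : ∀ i ∈ s, ‖f i‖ ≤ 1) :
    ‖∏ i ∈ s, f i‖ ≤ 1 := by
  rw [norm_prod]
  exact Finset.prod_le_one (fun i _ => norm_nonneg _) h

theorem norm_sum_cycles_sub_le (A B : ℤ → ℂ) (hA : ∀ n, A n ≠ 0 → -1 ≤ n ∧ n < (N : ℤ) - 1)
    (hA1 : ∀ n, ‖A n‖ ≤ 1) (hB1 : ∀ n, ‖B n‖ ≤ 1) (p q : ℕ → ℂ) (hp : ∀ n, ‖p n‖ ≤ 1)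
    (hq : ∀ n, ‖q n‖ ≤ 1) (hAp : ∀ n : ℕ, n + 1 < N → A n = p n)
    (hBq : ∀ n : ℕ, n + 1 < N → B n = q n)
    (ν : Fin (r + 1) →₀ ℕ) (hν : ∑ i, ν i = l) (u v : (Fin (r + 1) →₀ ℕ) → Fin (r + 1) → ℕ)
    (huv : ∀ μ ∈ weakComps (r + 1) l, ∀ s, v μ s = u μ s + μ s)
    (hvu : ∀ μ ∈ weakComps (r + 1) l, ∀ s, v μ s = u μ (finRotate _ s) + ν s)
    (hu : ∀ μ ∈ weakComps (r + 1) l, ∀ s, u μ s ≤ 2 * l)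
    (hv : ∀ μ ∈ weakComps (r + 1) l, ∀ s, v μ s ≤ 2 * l) :
    ‖∑ f : Fin (r + 1) → Fin N, ∏ s,
      (if (f s : ℕ) ≤ f (finRotate _ s) + ν s then
        A ((f s : ℤ) - 1) * B ((f (finRotate _ s) : ℤ) + ν s - 1) else 0) -
      ∑ μ ∈ weakComps (r + 1) l, ∑ j ∈ Finset.range N, ∏ s, p (j + u μ s) * q (j + v μ s)‖ ≤
    (weakComps (r + 1) l).card * (3 * (2 * l + 1 : ℕ)) := by
  rw [sum_cycles_eq A B hA ν hν u v huv hvu hu, Finset.sum_product, ← Finset.sum_sub_distrib,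
    ← nsmul_eq_mul]
  refine (norm_sum_le_of_le _ fun μ hμ => ?_).trans (Finset.sum_const _).le
  refine norm_sum_range_sub_le (fun n => ∏ s, A (n + u μ s) * B (n + v μ s)) _ ?_ ?_ _ ?_
  · refine fun n => norm_prod_le_one _ _ fun s _ => ?_
    rw [norm_mul]
    exact mul_le_one₀ (hA1 _) (norm_nonneg _) (hB1 _)
  · refine fun n => norm_prod_le_one _ _ fun s _ => ?_
    rw [norm_mul]
    exact mul_le_one₀ (hp _) (norm_nonneg _) (hq _)
  · intro n hn
    refine Finset.prod_congr rfl fun s _ => ?_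
    have h1 := hu μ hμ s
    have h2 := hv μ hμ s
    rw [← hAp _ (by omega), ← hBq _ (by omega)]
    push_cast
    rfl

end Cycles

/-! ### The map `φ` on monomials. -/

section Phi

variable {k : ℕ}

theorem phi_monomial (α : ℕ → ℂ) (e : Fin k ⊕ Fin k →₀ ℕ) (n : ℕ) :
    phi α (MvPolynomial.monomial e 1) n =
      ∏ i, α (n + e (Sum.inl i)) * conj (α (n + e (Sum.inr i))) := by
  rw [phi, show MvPolynomial.monomial e (1 : ℂ) =
    MvPolynomial.basisMonomials (Fin k ⊕ Fin k) ℂ e by simp, Module.Basis.constr_basis]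

end Phi

/-! ### The exponents satisfy the cycle relations. -/

section Exponents

variable {r l : ℕ}

theorem sum_Ici_castSucc (f : Fin (r + 1) → ℕ) (i : Fin r) :
    ∑ q ∈ Finset.Ici i.castSucc, f q = f i.castSucc + ∑ q ∈ Finset.Ici i.succ, f q := by
  rw [← Finset.sum_insert (by simp)]
  congr 1; ext a
  simp only [Finset.mem_Ici, Finset.mem_insert, Fin.le_def, Fin.ext_iff, Fin.val_castSucc,
    Fin.val_succ]
  omega

theorem sum_Ici_eq {k : ℕ} (f : Fin k → ℕ) (i : Fin k) :
    ∑ q ∈ Finset.Ici i, f q = ∑ q ∈ Finset.Ioi i, f q + f i := by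
  rw [add_comm, ← Finset.sum_insert (by simp)]
  congr 1; ext a
  simp only [Finset.mem_Ici, Finset.mem_Ioi, Finset.mem_insert, Fin.le_def, Fin.lt_def,
    Fin.ext_iff]
  omega

theorem sum_Iic_eq {k : ℕ} (f : Fin k → ℕ) (i : Fin k) :
    ∑ q ∈ Finset.Iic i, f q = ∑ q ∈ Finset.Iio i, f q + f i := by
  rw [add_comm, ← Finset.sum_insert (by simp)]
  congr 1; ext a
  simp only [Finset.mem_Iic, Finset.mem_Iio, Finset.mem_insert, Fin.le_def, Fin.lt_def,
    Fin.ext_iff]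
  omega

theorem sum_Iio_succ (f : Fin (r + 1) → ℕ) (i : Fin r) :
    ∑ q ∈ Finset.Iio i.succ, f q = ∑ q ∈ Finset.Iic i.castSucc, f q := by
  congr 1

theorem sum_le_of_mem_weakComps {k : ℕ} {μ : Fin k →₀ ℕ} (h : μ ∈ weakComps k l)
    (s : Finset (Fin k)) : ∑ i ∈ s, μ i ≤ l := by
  rw [← mem_weakComps.1 h]
  exact Finset.sum_le_sum_of_subset (Finset.subset_univ s)

theorem mem_weakComps_of_mem_comps {k : ℕ} {ν : Fin k →₀ ℕ} (h : ν ∈ comps k l) :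
    ν ∈ weakComps k l := mem_weakComps.2 (mem_comps.1 h).1

theorem expPos_inr_eq_add (ν μ : Fin (r + 1) →₀ ℕ) (s : Fin (r + 1)) :
    expPos ν μ (Sum.inr s) = expPos ν μ (Sum.inl s) + μ s := by
  simp only [expPos, Finsupp.coe_equivFunOnFinite_symm, Sum.elim_inl, Sum.elim_inr, sum_Iic_eq,
    add_assoc]

theorem finRotate_castSucc (i : Fin r) : finRotate (r + 1) i.castSucc = i.succ := by
  rw [finRotate_apply, Fin.coeSucc_eq_succ]

/-- At the last index the cycle wraps around to `0`. The relation closes up there because `ν` and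
`μ` have the same total `l`. -/
theorem expPos_inr_eq_rotate (ν μ : Fin (r + 1) →₀ ℕ) (hν : ν ∈ weakComps (r + 1) l)
    (hμ : μ ∈ weakComps (r + 1) l) (s : Fin (r + 1)) :
    expPos ν μ (Sum.inr s) = expPos ν μ (Sum.inl (finRotate _ s)) + ν s := by
  simp only [expPos, Finsupp.coe_equivFunOnFinite_symm, Sum.elim_inl, Sum.elim_inr]
  induction s using Fin.lastCases with
  | cast i => rw [finRotate_castSucc, sum_Ici_castSucc, sum_Iio_succ]; ring
  | last =>
    have h1 : (Finset.Iic (Fin.last r)) = Finset.univ := by ext a; simp [Fin.le_last]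
    have h2 : (Finset.Ici (0 : Fin (r + 1))) = Finset.univ := by ext a; simp
    have h3 : (Finset.Iio (0 : Fin (r + 1))) = ∅ := by ext a; simp
    have h4 : (Finset.Ici (Fin.last r)) = {Fin.last r} := by
      ext a; simp
    rw [finRotate_last, h1, h2, h3, h4, mem_weakComps.1 hν, mem_weakComps.1 hμ,
      Finset.sum_singleton, Finset.sum_empty]
    ring

theorem expPos_le {k : ℕ} {ν μ : Fin k →₀ ℕ} (hν : ν ∈ weakComps k l)
    (hμ : μ ∈ weakComps k l) (i : Fin k ⊕ Fin k) : expPos ν μ i ≤ 2 * l := by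
  rw [two_mul]
  cases i <;> exact add_le_add (sum_le_of_mem_weakComps hν _) (sum_le_of_mem_weakComps hμ _)

theorem expNeg_le {k : ℕ} {ν μ : Fin k →₀ ℕ} (hν : ν ∈ weakComps k l)
    (hμ : μ ∈ weakComps k l) (i : Fin k ⊕ Fin k) : expNeg ν μ i ≤ 2 * l := by
  rw [two_mul]
  cases i <;> exact add_le_add (sum_le_of_mem_weakComps hν _) (sum_le_of_mem_weakComps hμ _)

theorem expNeg_inl_eq_add (ν μ : Fin (r + 1) →₀ ℕ) (s : Fin (r + 1)) :
    expNeg ν μ (Sum.inl s) = expNeg ν μ (Sum.inr s) + ν s := by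
  simp only [expNeg, Finsupp.coe_equivFunOnFinite_symm, Sum.elim_inl, Sum.elim_inr, sum_Ici_eq]
  ring

/-- For the adjoint the conjugated factors lead each block, so the rotation falls on the
`x`-exponents and is paired with `μ`. The wrap-around again uses that both totals equal `l`. -/
theorem expNeg_inl_rotate (ν μ : Fin (r + 1) →₀ ℕ) (hν : ν ∈ weakComps (r + 1) l)
    (hμ : μ ∈ weakComps (r + 1) l) (s : Fin (r + 1)) :
    expNeg ν μ (Sum.inl (finRotate _ s)) = expNeg ν μ (Sum.inr s) + μ s := by
  simp only [expNeg, Finsupp.coe_equivFunOnFinite_symm, Sum.elim_inl, Sum.elim_inr]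
  induction s using Fin.lastCases with
  | cast i =>
    have h := sum_Ici_castSucc ν i
    rw [sum_Ici_eq] at h
    rw [finRotate_castSucc, sum_Iio_succ, sum_Iic_eq]
    omega
  | last =>
    have h1 : (Finset.Iic (Fin.last r)) = Finset.univ := by ext a; simp [Fin.le_last]
    have h2 : (Finset.Ici (0 : Fin (r + 1))) = Finset.univ := by ext a; simp
    have h3 : (Finset.Iio (0 : Fin (r + 1))) = ∅ := by ext a; simp
    have h4 : (Finset.Ioi (Fin.last r)) = ∅ := by
      ext a; simp [Fin.le_last]
    have h := sum_Iic_eq μ (Fin.last r)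
    rw [h1, mem_weakComps.1 hμ] at h
    rw [finRotate_last, h2, h3, h4, mem_weakComps.1 hν, Finset.sum_empty, Finset.sum_empty]
    omega

end Exponents

/-! ### The truncated GGT matrix and the traces of its powers. -/

section GGT

variable {N : ℕ} (α : ℕ → ℂ)

/-- The left factors `α_{n}`, `-1 ≤ n ≤ N - 2`, of the entries of `U_N`. -/
def leftSeq (N : ℕ) (n : ℤ) : ℂ := if n < (N : ℤ) - 1 then extend α n else 0

/-- The right factors `conj α_{n}`, `0 ≤ n ≤ N - 1`, of the entries of `U_N`. -/
def rightSeq (N : ℕ) (n : ℤ) : ℂ := if 0 ≤ n ∧ n < N then conj (α n.toNat) else 0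

theorem rho_sq {n : ℕ} (h : ‖α n‖ < 1) : (rho α n : ℂ) ^ 2 = 1 - α n * conj (α n) := by
  rw [rho, ← Complex.ofReal_pow, Real.sq_sqrt (by nlinarith [norm_nonneg (α n)]),
    Complex.mul_conj, Complex.normSq_eq_norm_sq]
  push_cast; ring

theorem rho_ne_zero {n : ℕ} (h : ‖α n‖ < 1) : (rho α n : ℂ) ≠ 0 := by
  rw [rho, Complex.ofReal_ne_zero]
  exact (Real.sqrt_pos.2 (by nlinarith [norm_nonneg (α n)])).ne'

/-- On and above the diagonal, the conjugation absorbs the products of `ρ`. On the subdiagonal it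
produces `ρ² = 1 - |α|²`, where `1` belongs to the shift and `|α|²` extends the rank-one pattern one
step below the diagonal. -/
theorem semiconj_ggt (hα : ∀ n, ‖α n‖ < 1) :
    SemiconjBy (Matrix.diagonal fun c : Fin N => ∏ j ∈ Finset.range c, (rho α j : ℂ))
      (ggt α N) (shiftMat N - hessMat (leftSeq α N) (rightSeq α N) N) := by
  ext c c'
  rw [Matrix.diagonal_mul, Matrix.mul_diagonal, Matrix.sub_apply, shiftMat, hessMat, ggt,
    Matrix.of_apply, Matrix.of_apply, Matrix.of_apply]
  have hl : leftSeq α N ((c : ℤ) - 1) = extend α ((c : ℤ) - 1) := if_pos (by omega)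
  have hr : rightSeq α N c' = conj (α c') := by
    rw [rightSeq, if_pos (by omega), Int.toNat_natCast]
  rw [hl, hr]
  by_cases h1 : (c : ℕ) ≤ c'
  · rw [if_pos h1, if_neg (by omega), if_pos (by omega), ← Finset.prod_range_mul_prod_Ico _ h1]
    ring
  · by_cases h2 : (c : ℕ) = c' + 1
    · rw [if_neg h1, if_pos h2, if_pos h2, if_pos h2.le, h2, Finset.prod_range_succ]
      have : extend α (((c' + 1 : ℕ) : ℤ) - 1) = α c' := by
        rw [Nat.cast_add, Nat.cast_one, add_sub_cancel_right, extend, if_pos (by omega),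
          Int.toNat_natCast]
      rw [this]
      linear_combination (∏ j ∈ Finset.range c', (rho α j : ℂ)) * rho_sq α (hα c')
    · rw [if_neg h1, if_neg h2, if_neg h2, if_neg (by omega)]
      ring

theorem trace_ggt_pow (hα : ∀ n, ‖α n‖ < 1) (l : ℕ) :
    (ggt α N ^ l).trace =
      ((shiftMat N - hessMat (leftSeq α N) (rightSeq α N) N) ^ l).trace := by
  have h := ((semiconj_ggt (N := N) α hα).pow_right l).eq
  have hd : IsUnit (Matrix.diagonal fun c : Fin N => ∏ j ∈ Finset.range c, (rho α j : ℂ)) := by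
    rw [Matrix.isUnit_diagonal, Pi.isUnit_iff]
    exact fun c => (Finset.prod_ne_zero_iff.2 fun j _ => rho_ne_zero α (hα j)).isUnit
  obtain ⟨D, hD⟩ := hd
  rw [← hD] at h
  rw [← Matrix.trace_units_conj D (ggt α N ^ l), h, mul_assoc, Units.mul_inv, mul_one]

theorem leftSeq_ne_zero {n : ℤ} (h : leftSeq α N n ≠ 0) : -1 ≤ n ∧ n < (N : ℤ) - 1 := by
  rw [leftSeq] at h
  split_ifs at h with h1
  · refine ⟨?_, h1⟩
    rw [extend] at h
    split_ifs at h with h2 h3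
    · omega
    · omega
    · exact absurd rfl h
  · exact absurd rfl h

theorem rightSeq_ne_zero {n : ℤ} (h : rightSeq α N n ≠ 0) : n < N := by
  rw [rightSeq] at h
  split_ifs at h with h1
  · exact h1.2
  · exact absurd rfl h

theorem norm_leftSeq_le (hα : ∀ n, ‖α n‖ < 1) (n : ℤ) : ‖leftSeq α N n‖ ≤ 1 := by
  rw [leftSeq, extend]
  split_ifs <;> simp [(hα _).le]

theorem norm_rightSeq_le (hα : ∀ n, ‖α n‖ < 1) (n : ℤ) : ‖rightSeq α N n‖ ≤ 1 := by
  rw [rightSeq]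
  split_ifs <;> simp [(hα _).le]

theorem leftSeq_natCast {n : ℕ} (h : n + 1 < N) : leftSeq α N n = α n := by
  rw [leftSeq, if_pos (by omega), extend, if_pos (by omega), Int.toNat_natCast]

theorem rightSeq_natCast {n : ℕ} (h : n + 1 < N) : rightSeq α N n = conj (α n) := by
  rw [rightSeq, if_pos (by omega), Int.toNat_natCast]

theorem sum_cycles_hessMat {r l : ℕ} (A B : ℤ → ℂ) (hB : ∀ n, B n ≠ 0 → n < N)
    (ν : Fin (r + 1) →₀ ℕ) (hν : ν ∈ comps (r + 1) l) :
    ∑ f : Fin (r + 1) → Fin N,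
      ∏ s, (hessMat A B N * shiftMat N ^ (ν s - 1)) (f s) (f (finRotate _ s)) =
    ∑ f : Fin (r + 1) → Fin N, ∏ s,
      (if (f s : ℕ) ≤ f (finRotate _ s) + ν s then
        A ((f s : ℤ) - 1) * B ((f (finRotate _ s) : ℤ) + ν s - 1) else 0) :=
  Finset.sum_congr rfl fun _ _ => Finset.prod_congr rfl fun s _ =>
    hessMat_mul_shiftMat_pow A B hB ((mem_comps.1 hν).2 s) _ _

theorem norm_sum_sub_sum_le {ι : Type*} (s : Finset ι) (f g : ι → ℂ) (C : ℝ)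
    (h : ∀ i ∈ s, ‖f i - g i‖ ≤ C) : ‖∑ i ∈ s, f i - ∑ i ∈ s, g i‖ ≤ s.card * C := by
  rw [← Finset.sum_sub_distrib, ← nsmul_eq_mul]
  exact (norm_sum_le_of_le _ h).trans (Finset.sum_const _).le

theorem sum_phi_sum {ι : Type*} {k : ℕ} (s : Finset ι) (P : ι → PolyRing k) (M : ℕ) :
    ∑ j ∈ Finset.range M, phi α (∑ i ∈ s, P i) j =
      ∑ i ∈ s, ∑ j ∈ Finset.range M, phi α (P i) j := by
  simp only [map_sum, Finset.sum_apply]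
  exact Finset.sum_comm

theorem norm_cycles_sub_polyPos_le (hα : ∀ n, ‖α n‖ < 1) (r l : ℕ) :
    ∃ C : ℝ, ∀ N : ℕ, ‖∑ ν ∈ comps (r + 1) l, ∑ f : Fin (r + 1) → Fin N,
        ∏ s, (hessMat (leftSeq α N) (rightSeq α N) N * shiftMat N ^ (ν s - 1))
          (f s) (f (finRotate _ s)) -
      ∑ j ∈ Finset.range N, phi α (polyPos (r + 1) l) j‖ ≤ C := by
  refine ⟨(comps (r + 1) l).card * ((weakComps (r + 1) l).card * (3 * (2 * l + 1 : ℕ))),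
    fun N => ?_⟩
  simp only [polyPos, sum_phi_sum]
  refine norm_sum_sub_sum_le _ _ _ _ fun ν hν => ?_
  have hν' := mem_weakComps_of_mem_comps hν
  rw [sum_cycles_hessMat _ _ (fun n => rightSeq_ne_zero α) ν hν]
  simp only [phi_monomial]
  exact norm_sum_cycles_sub_le _ _ (fun n => leftSeq_ne_zero α) (norm_leftSeq_le α hα)
    (norm_rightSeq_le α hα) α (fun n => conj (α n)) (fun n => (hα n).le)
    (fun n => by simpa using (hα n).le) (fun n => leftSeq_natCast α) (fun n => rightSeq_natCast α)
    ν (mem_comps.1 hν).1 (fun μ s => expPos ν μ (Sum.inl s)) (fun μ s => expPos ν μ (Sum.inr s))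
    (fun μ _ s => expPos_inr_eq_add ν μ s) (fun μ hμ s => expPos_inr_eq_rotate ν μ hν' hμ s)
    (fun μ hμ s => expPos_le hν' hμ _) (fun μ hμ s => expPos_le hν' hμ _)

theorem norm_cycles_sub_polyNeg_le (hα : ∀ n, ‖α n‖ < 1) (r l : ℕ) :
    ∃ C : ℝ, ∀ N : ℕ, ‖∑ ν ∈ comps (r + 1) l, ∑ f : Fin (r + 1) → Fin N,
        ∏ s, (hessMat (fun n => conj (leftSeq α N n)) (fun n => conj (rightSeq α N n)) N *
          shiftMat N ^ (ν s - 1)) (f s) (f (finRotate _ s)) -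
      ∑ j ∈ Finset.range N, phi α (polyNeg (r + 1) l) j‖ ≤ C := by
  refine ⟨(comps (r + 1) l).card * ((weakComps (r + 1) l).card * (3 * (2 * l + 1 : ℕ))),
    fun N => ?_⟩
  simp only [polyNeg, sum_phi_sum]
  -- With the `x`-exponents read at the rotated index, block `s` has length `ν (s + 1)`. The sum
  -- over compositions is therefore reindexed by a rotation.
  let rot := Finsupp.equivCongrLeft (M := ℕ) (finRotate (r + 1)).symm
  have hrot : ∀ ν s, rot ν s = ν (finRotate _ s) := fun ν s => by
    simp [rot, Finsupp.equivCongrLeft_apply, Finsupp.equivMapDomain_apply]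
  have hcomps : ∀ ν, ν ∈ comps (r + 1) l ↔ rot ν ∈ comps (r + 1) l := fun ν => by
    simp only [mem_comps, hrot]
    rw [Equiv.sum_comp (finRotate (r + 1)) ν]
    exact and_congr_right fun _ => ⟨fun h i => h _, fun h i => by
      have := h ((finRotate _).symm i)
      rwa [Equiv.apply_symm_apply] at this⟩
  rw [← Finset.sum_equiv rot (s := comps (r + 1) l) (g := fun ν => ∑ f : Fin (r + 1) → Fin N,
        ∏ s, (hessMat (fun n => conj (leftSeq α N n)) (fun n => conj (rightSeq α N n)) N *
          shiftMat N ^ (ν s - 1)) (f s) (f (finRotate _ s))) hcomps fun _ _ => rfl]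
  refine norm_sum_sub_sum_le _ _ _ _ fun ν hν => ?_
  have hν' := mem_weakComps_of_mem_comps hν
  rw [sum_cycles_hessMat _ _ (fun n h => rightSeq_ne_zero α fun h' => h (by simp [h']))
    (rot ν) ((hcomps ν).1 hν)]
  have hphi : ∀ μ j, phi α (MvPolynomial.monomial (expNeg ν μ) 1) j = ∏ s,
      conj (α (j + expNeg ν μ (Sum.inr s))) * α (j + expNeg ν μ (Sum.inl (finRotate _ s))) :=
    fun μ j => by
      rw [phi_monomial, Finset.prod_mul_distrib, Finset.prod_mul_distrib,
        Equiv.prod_comp (finRotate (r + 1)) fun s => α (j + expNeg ν μ (Sum.inl s)), mul_comm]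
  simp only [hphi]
  refine norm_sum_cycles_sub_le (fun n => conj (leftSeq α N n)) (fun n => conj (rightSeq α N n))
    ?_ ?_ ?_ (fun n => conj (α n)) α ?_ (fun n => (hα n).le) ?_ ?_
    (rot ν) (mem_comps.1 ((hcomps ν).1 hν)).1 (fun μ s => expNeg ν μ (Sum.inr s))
    (fun μ s => expNeg ν μ (Sum.inl (finRotate _ s))) ?_ ?_ ?_ ?_
  · exact fun n h => leftSeq_ne_zero (N := N) α fun h' => h (by simp [h'])
  · exact fun n => (RCLike.norm_conj _).trans_le (norm_leftSeq_le α hα n)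
  · exact fun n => (RCLike.norm_conj _).trans_le (norm_rightSeq_le α hα n)
  · exact fun n => (RCLike.norm_conj _).trans_le (hα n).le
  · exact fun n h => by rw [leftSeq_natCast α h]
  · exact fun n h => by rw [rightSeq_natCast α h, Complex.conj_conj]
  · exact fun μ hμ s => expNeg_inl_rotate ν μ hν' hμ s
  · exact fun μ hμ s => by rw [hrot, expNeg_inl_eq_add]
  · exact fun μ hμ s => expNeg_le hν' hμ _
  · exact fun μ hμ s => expNeg_le hν' hμ _

theorem exists_norm_sum_mul_sub_le {ι : Type*} (s : Finset ι) (c : ι → ℂ) (f g : ι → ℕ → ℂ)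
    (h : ∀ i ∈ s, ∃ C : ℝ, ∀ N, ‖f i N - g i N‖ ≤ C) :
    ∃ C : ℝ, ∀ N, ‖∑ i ∈ s, c i * f i N - ∑ i ∈ s, c i * g i N‖ ≤ C := by
  choose! C hC using h
  refine ⟨∑ i ∈ s, ‖c i‖ * C i, fun N => ?_⟩
  rw [← Finset.sum_sub_distrib]
  refine norm_sum_le_of_le _ fun i hi => ?_
  rw [← mul_sub, norm_mul]
  exact mul_le_mul_of_nonneg_left (hC i hi N) (norm_nonneg _)

theorem exists_norm_trace_ggt_pow_sub_le (hα : ∀ n, ‖α n‖ < 1) {l : ℕ} (hl : 0 < l) :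
    ∃ C : ℝ, ∀ N : ℕ, ‖(ggt α N ^ l).trace - ∑ k ∈ Finset.range l,
      (-1) ^ (k + 1) * ((l : ℂ) / ((k : ℂ) + 1)) *
        ∑ j ∈ Finset.range N, phi α (polyPos (k + 1) l) j‖ ≤ C := by
  simp only [trace_ggt_pow α hα, trace_sub_pow _ _ hl (trace_shiftMat_pow hl)]
  exact exists_norm_sum_mul_sub_le _ _ _ _ fun k _ => norm_cycles_sub_polyPos_le α hα k l

theorem exists_norm_trace_conjTranspose_ggt_pow_sub_le (hα : ∀ n, ‖α n‖ < 1) {l : ℕ}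
    (hl : 0 < l) :
    ∃ C : ℝ, ∀ N : ℕ, ‖((ggt α N).conjTranspose ^ l).trace - ∑ k ∈ Finset.range l,
      (-1) ^ (k + 1) * ((l : ℂ) / ((k : ℂ) + 1)) *
        ∑ j ∈ Finset.range N, phi α (polyNeg (k + 1) l) j‖ ≤ C := by
  have h : ∀ N, ((ggt α N).conjTranspose ^ l).trace = ((shiftMat N -
      hessMat (fun n => conj (leftSeq α N n)) (fun n => conj (rightSeq α N n)) N) ^ l).trace :=
    fun N => by
      -- The trace of the adjoint's power is the conjugate of the original trace, and the shift is
      -- real, so only the entries of the Hessenberg part are conjugated.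
      have e : shiftMat N -
          hessMat (fun n => conj (leftSeq α N n)) (fun n => conj (rightSeq α N n)) N =
          (shiftMat N - hessMat (leftSeq α N) (rightSeq α N) N).map (starRingEnd ℂ) := by
        ext i j
        simp only [shiftMat, hessMat, Matrix.sub_apply, Matrix.of_apply, Matrix.map_apply, map_sub,
          apply_ite (starRingEnd ℂ), map_mul, map_one, map_zero]
      rw [← Matrix.conjTranspose_pow, Matrix.trace_conjTranspose, trace_ggt_pow α hα, e,
        ← Matrix.map_pow]
      simp [Matrix.trace]
  simp only [h, trace_sub_pow _ _ hl (trace_shiftMat_pow hl)]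
  exact exists_norm_sum_mul_sub_le _ _ _ _ fun k _ => norm_cycles_sub_polyNeg_le α hα k l

end GGT

/-! ### Polynomials in `α` and `conj α` as functions, and symmetrization. -/

section Encode

variable {k : ℕ}

theorem ext_monomial_one {σ M : Type*} [AddCommMonoid M] [Module ℂ M]
    {f g : MvPolynomial σ ℂ →ₗ[ℂ] M}
    (h : ∀ e, f (MvPolynomial.monomial e 1) = g (MvPolynomial.monomial e 1)) (P : MvPolynomial σ ℂ) :
    f P = g P := by
  refine DFunLike.congr_fun ((MvPolynomial.basisMonomials σ ℂ).ext fun e => ?_) P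
  simpa using h e

/-- The linear map with prescribed values on monomials. -/
def ofMonomials {σ M : Type*} [AddCommMonoid M] [Module ℂ M] (f : (σ →₀ ℕ) → M) :
    MvPolynomial σ ℂ →ₗ[ℂ] M :=
  (MvPolynomial.basisMonomials σ ℂ).constr ℂ f

theorem ofMonomials_monomial {σ M : Type*} [AddCommMonoid M] [Module ℂ M] (f : (σ →₀ ℕ) → M)
    (e : σ →₀ ℕ) : ofMonomials f (MvPolynomial.monomial e 1) = f e := by
  rw [ofMonomials, show MvPolynomial.monomial e (1 : ℂ) =
    MvPolynomial.basisMonomials σ ℂ e by simp, Module.Basis.constr_basis]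

theorem ofMonomials_apply {σ M : Type*} [AddCommMonoid M] [Module ℂ M] (f : (σ →₀ ℕ) → M)
    (P : MvPolynomial σ ℂ) : ofMonomials f P = ∑ e ∈ P.support, P.coeff e • f e := by
  conv_lhs => rw [P.as_sum]
  rw [map_sum]
  refine Finset.sum_congr rfl fun e _ => ?_
  rw [← ofMonomials_monomial f e, ← map_smul, MvPolynomial.smul_monomial, smul_eq_mul, mul_one]

/-- The exponent of `∏ X_{g(β_i)} Y_{g(γ_i)}`. -/
def codeExp {ι : Type*} (g : ℕ → ι) (e : Fin k ⊕ Fin k →₀ ℕ) : ι ⊕ ι →₀ ℕ :=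
  ∑ i, (Finsupp.single (Sum.inl (g (e (Sum.inl i)))) 1 +
    Finsupp.single (Sum.inr (g (e (Sum.inr i)))) 1)

/-- The linear map `∏ x_i^{β_i} y_i^{γ_i} ↦ ∏ X_{g(β_i)} Y_{g(γ_i)}`. -/
def encode {ι : Type*} (g : ℕ → ι) : PolyRing k →ₗ[ℂ] MvPolynomial (ι ⊕ ι) ℂ :=
  ofMonomials fun e => MvPolynomial.monomial (codeExp g e) 1

theorem eval_monomial_codeExp {ι : Type*} (g : ℕ → ι) (e : Fin k ⊕ Fin k →₀ ℕ) (z z' : ι → ℂ) :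
    MvPolynomial.eval (Sum.elim z z') (MvPolynomial.monomial (codeExp g e) 1) =
      ∏ i, z (g (e (Sum.inl i))) * z' (g (e (Sum.inr i))) := by
  have : MvPolynomial.monomial (codeExp g e) (1 : ℂ) =
      ∏ i, MvPolynomial.X (Sum.inl (g (e (Sum.inl i)))) *
        MvPolynomial.X (Sum.inr (g (e (Sum.inr i)))) := by
    rw [codeExp, MvPolynomial.monomial_sum_one]
    refine Finset.prod_congr rfl fun i _ => ?_
    rw [MvPolynomial.X, MvPolynomial.X, MvPolynomial.monomial_mul, one_mul]
  rw [this]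
  simp

theorem eval_encode_id (α : ℕ → ℂ) (P : PolyRing k) :
    MvPolynomial.eval (Sum.elim α fun i => conj (α i)) (encode id P) = phi α P 0 := by
  have := ext_monomial_one
    (f := (MvPolynomial.aeval (Sum.elim α fun i => conj (α i))).toLinearMap.comp
      (encode (k := k) id)) (g := (LinearMap.proj 0).comp (phi α)) (fun e => ?_) P
  · simpa [MvPolynomial.coe_aeval_eq_eval] using this
  · simp only [LinearMap.comp_apply, LinearMap.proj_apply, encode, ofMonomials_monomial,
      phi_monomial]
    exact (eval_monomial_codeExp _ _ _ _).trans (by simp)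

/-- After the invertible substitution `z = x + i y`, `conj z = x - i y`, the polynomial vanishes for
all real `x, y` in `(0, 1/2)`, a product of infinite sets, and so it is zero. -/
theorem eq_zero_of_eval_conj {ι : Type*} (G : MvPolynomial (ι ⊕ ι) ℂ)
    (h : ∀ z : ι → ℂ, (∀ i, ‖z i‖ < 1) →
      MvPolynomial.eval (Sum.elim z fun i => conj (z i)) G = 0) : G = 0 := by
  let w : ι ⊕ ι → MvPolynomial (ι ⊕ ι) ℂ := Sum.elim
    (fun i => MvPolynomial.X (Sum.inl i) + MvPolynomial.C Complex.I * MvPolynomial.X (Sum.inr i))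
    (fun i => MvPolynomial.X (Sum.inl i) - MvPolynomial.C Complex.I * MvPolynomial.X (Sum.inr i))
  have hev : ∀ x, MvPolynomial.eval x (MvPolynomial.bind₁ w G) =
      MvPolynomial.eval (Sum.elim (fun i => x (Sum.inl i) + Complex.I * x (Sum.inr i))
        (fun i => x (Sum.inl i) - Complex.I * x (Sum.inr i))) G := fun x => by
    rw [← MvPolynomial.coe_aeval_eq_eval, ← MvPolynomial.coe_aeval_eq_eval, RingHom.coe_coe,
      MvPolynomial.aeval_bind₁]
    refine congrArg (fun f => MvPolynomial.aeval f G) (funext fun i => ?_)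
    cases i <;> simp [w]
  have hzero : MvPolynomial.bind₁ w G = 0 := by
    refine MvPolynomial.funext_set (fun _ => (fun t : ℝ => (t : ℂ)) '' Set.Ioo (0 : ℝ) (1 / 2))
      (fun _ => (Set.Ioo_infinite (by norm_num)).image Complex.ofReal_injective.injOn) fun x hx => ?_
    rw [hev, map_zero]
    have hx' : ∀ i, ∃ t : ℝ, t ∈ Set.Ioo (0 : ℝ) (1 / 2) ∧ (t : ℂ) = x i := fun i =>
      hx i (Set.mem_univ i)
    choose t ht htx using hx'
    have := h (fun i => x (Sum.inl i) + Complex.I * x (Sum.inr i)) fun i => by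
      refine (norm_add_le _ _).trans_lt ?_
      rw [norm_mul, Complex.norm_I, one_mul, ← htx, ← htx, Complex.norm_real, Complex.norm_real,
        Real.norm_of_nonneg (ht _).1.le, Real.norm_of_nonneg (ht _).1.le]
      linarith [(ht (Sum.inl i)).2, (ht (Sum.inr i)).2]
    rw [← this]
    congr 2
    funext i
    cases i with
    | inl i => rfl
    | inr i =>
      simp only [Sum.elim_inr, map_add, map_mul, Complex.conj_I, ← htx, Complex.conj_ofReal]
      ring
  refine MvPolynomial.funext fun v => ?_
  have := hev (Sum.elim (fun i => (v (Sum.inl i) + v (Sum.inr i)) / 2)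
    (fun i => (v (Sum.inl i) - v (Sum.inr i)) / (2 * Complex.I)))
  rw [hzero, map_zero] at this
  rw [map_zero, this]
  congr 2
  funext i
  have hI := Complex.I_ne_zero
  cases i with
  | inl i => simp only [Sum.elim_inl, Sum.elim_inr]; field_simp; ring
  | inr i => simp only [Sum.elim_inl, Sum.elim_inr]; field_simp; ring

theorem exists_perm_of_card_fiber_eq {ι κ : Type*} [Fintype ι] [DecidableEq κ] (f g : ι → κ)
    (h : ∀ n, Fintype.card {i // f i = n} = Fintype.card {i // g i = n}) :
    ∃ σ : Equiv.Perm ι, ∀ i, f i = g (σ i) := by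
  let E : ∀ n, {i // f i = n} ≃ {i // g i = n} := fun n => Fintype.equivOfCardEq (h n)
  refine ⟨((Equiv.sigmaFiberEquiv f).symm.trans (Equiv.sigmaCongrRight E)).trans
    (Equiv.sigmaFiberEquiv g), fun i => ?_⟩
  exact (E (f i) ⟨i, rfl⟩).2.symm

theorem codeExp_id_inl (e : Fin k ⊕ Fin k →₀ ℕ) (n : ℕ) :
    codeExp id e (Sum.inl n) = Fintype.card {i // e (Sum.inl i) = n} := by
  rw [codeExp, Finsupp.finsetSum_apply, Fintype.card_subtype]
  simp [Finsupp.single_apply]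

theorem codeExp_id_inr (e : Fin k ⊕ Fin k →₀ ℕ) (n : ℕ) :
    codeExp id e (Sum.inr n) = Fintype.card {i // e (Sum.inr i) = n} := by
  rw [codeExp, Finsupp.finsetSum_apply, Fintype.card_subtype]
  simp [Finsupp.single_apply]

/-- The sum over all permutations of the `x_i` and of the `y_i`. -/
def symm (k : ℕ) : PolyRing k →ₗ[ℂ] PolyRing k :=
  ∑ σ : Equiv.Perm (Fin k), ∑ τ : Equiv.Perm (Fin k),
    (MvPolynomial.rename (Sum.map σ τ)).toLinearMap

theorem symm_apply (P : PolyRing k) : symm k P =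
    ∑ σ : Equiv.Perm (Fin k), ∑ τ : Equiv.Perm (Fin k), MvPolynomial.rename (Sum.map σ τ) P := by
  simp [symm, LinearMap.sum_apply]

theorem symm_rename (σ τ : Equiv.Perm (Fin k)) (P : PolyRing k) :
    symm k (MvPolynomial.rename (Sum.map σ τ) P) = symm k P := by
  rw [symm_apply, symm_apply, ← Equiv.sum_comp (Equiv.mulRight σ)
    fun σ' => ∑ τ' : Equiv.Perm (Fin k), MvPolynomial.rename (Sum.map σ' τ') P]
  refine Finset.sum_congr rfl fun σ' _ => ?_
  rw [← Equiv.sum_comp (Equiv.mulRight τ)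
    fun τ' => MvPolynomial.rename (Sum.map (Equiv.mulRight σ σ') τ') P]
  refine Finset.sum_congr rfl fun τ' _ => ?_
  rw [MvPolynomial.rename_rename, Sum.map_comp_map]
  rfl

/-- The commutative monomial in the `α`'s remembers the multiset of `x`-exponents and the multiset
of `y`-exponents. Two monomials with the same multisets differ by a pair of permutations, which
symmetrization does not see. -/
theorem symm_monomial_eq_of_codeExp_eq {e e' : Fin k ⊕ Fin k →₀ ℕ}
    (h : codeExp id e = codeExp id e') :
    symm k (MvPolynomial.monomial e 1) = symm k (MvPolynomial.monomial e' 1) := by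
  obtain ⟨σ, hσ⟩ := exists_perm_of_card_fiber_eq (fun i => e (Sum.inl i)) (fun i => e' (Sum.inl i))
    fun n => by rw [← codeExp_id_inl, h, codeExp_id_inl]
  obtain ⟨τ, hτ⟩ := exists_perm_of_card_fiber_eq (fun i => e (Sum.inr i)) (fun i => e' (Sum.inr i))
    fun n => by rw [← codeExp_id_inr, h, codeExp_id_inr]
  rw [← symm_rename σ τ (MvPolynomial.monomial e 1), MvPolynomial.rename_monomial]
  have hinj : Function.Injective (Sum.map σ τ) := σ.injective.sumMap τ.injective
  refine congrArg (fun a => symm k (MvPolynomial.monomial a 1)) (Finsupp.ext fun i => ?_)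
  obtain ⟨j, rfl⟩ : ∃ j, Sum.map σ τ j = i := (σ.surjective.sumMap τ.surjective) i
  rw [Finsupp.mapDomain_apply hinj]
  cases j with
  | inl j => exact hσ j
  | inr j => exact hτ j

/-- The encoded polynomial vanishes identically by `eq_zero_of_eval_conj`, and symmetrization
factors through the encoding by `symm_monomial_eq_of_codeExp_eq`. -/
theorem symm_eq_zero_of_phi_eq_zero (P : PolyRing k)
    (h : ∀ α : ℕ → ℂ, (∀ n, ‖α n‖ < 1) → phi α P 0 = 0) : symm k P = 0 := by
  classical
  have h0 : encode id P = 0 := eq_zero_of_eval_conj _ fun z hz => by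
    rw [eval_encode_id, h z hz]
  let Ψ : MvPolynomial (ℕ ⊕ ℕ) ℂ →ₗ[ℂ] PolyRing k := ofMonomials fun E =>
    if h : ∃ e : Fin k ⊕ Fin k →₀ ℕ, codeExp id e = E then
      symm k (MvPolynomial.monomial h.choose 1) else 0
  have hΨ := ext_monomial_one (f := Ψ.comp (encode id)) (g := symm k) (fun e => by
    have hex : ∃ e' : Fin k ⊕ Fin k →₀ ℕ, codeExp id e' = codeExp id e := ⟨e, rfl⟩
    rw [LinearMap.comp_apply, encode, ofMonomials_monomial, ofMonomials_monomial, dif_pos hex]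
    exact symm_monomial_eq_of_codeExp_eq hex.choose_spec) P
  rw [← hΨ, LinearMap.comp_apply, h0, map_zero]

theorem phi_rename (α : ℕ → ℂ) (σ τ : Equiv.Perm (Fin k)) (P : PolyRing k) :
    phi α (MvPolynomial.rename (Sum.map σ τ) P) = phi α P := by
  refine ext_monomial_one (f := (phi α).comp (MvPolynomial.rename (Sum.map σ τ)).toLinearMap)
    (g := phi α) (fun e => ?_) P
  have hinj : Function.Injective (Sum.map σ τ) := σ.injective.sumMap τ.injective
  have hl : ∀ i, Finsupp.mapDomain (Sum.map σ τ) e (Sum.inl (σ i)) = e (Sum.inl i) := fun i =>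
    Finsupp.mapDomain_apply hinj e (Sum.inl i)
  have hr : ∀ i, Finsupp.mapDomain (Sum.map σ τ) e (Sum.inr (τ i)) = e (Sum.inr i) := fun i =>
    Finsupp.mapDomain_apply hinj e (Sum.inr i)
  funext n
  rw [LinearMap.comp_apply, AlgHom.toLinearMap_apply, MvPolynomial.rename_monomial, phi_monomial,
    phi_monomial, Finset.prod_mul_distrib, Finset.prod_mul_distrib,
    ← Equiv.prod_comp σ fun i => α (n + Finsupp.mapDomain (Sum.map σ τ) e (Sum.inl i)),
    ← Equiv.prod_comp τ fun i => conj (α (n + Finsupp.mapDomain (Sum.map σ τ) e (Sum.inr i)))]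
  simp only [hl, hr]

theorem phi_symm (α : ℕ → ℂ) (P : PolyRing k) :
    phi α (symm k P) = ((k.factorial : ℂ) ^ 2) • phi α P := by
  rw [symm_apply]
  simp only [map_sum, phi_rename, Finset.sum_const, Finset.card_univ, Fintype.card_perm,
    Fintype.card_fin]
  rw [smul_smul, ← Nat.cast_smul_eq_nsmul ℂ]
  push_cast
  rw [sq]

end Encode

/-! ### Bounded partial sums and divisibility by `w - 1`. -/

section Normalize

variable {k : ℕ}

/-- The smallest exponent. -/
def minExp (e : Fin k ⊕ Fin k →₀ ℕ) : ℕ := ⨅ i, e i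

/-- The exponent translated so that its smallest entry is `0`. -/
def nrmExp (e : Fin k ⊕ Fin k →₀ ℕ) : Fin k ⊕ Fin k →₀ ℕ :=
  Finsupp.equivFunOnFinite.symm fun i => e i - minExp e

theorem minExp_le (e : Fin k ⊕ Fin k →₀ ℕ) (i : Fin k ⊕ Fin k) : minExp e ≤ e i :=
  ciInf_le (OrderBot.bddBelow _) i

theorem exists_eq_minExp (hk : 0 < k) (e : Fin k ⊕ Fin k →₀ ℕ) : ∃ i, e i = minExp e := by
  have : Nonempty (Fin k ⊕ Fin k) := ⟨Sum.inl ⟨0, hk⟩⟩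
  exact exists_eq_ciInf_of_finite

theorem nrmExp_apply (e : Fin k ⊕ Fin k →₀ ℕ) (i : Fin k ⊕ Fin k) :
    nrmExp e i = e i - minExp e := rfl

theorem exists_nrmExp_eq_zero (hk : 0 < k) (e : Fin k ⊕ Fin k →₀ ℕ) : ∃ i, nrmExp e i = 0 := by
  obtain ⟨i, hi⟩ := exists_eq_minExp hk e
  exact ⟨i, by rw [nrmExp_apply, hi, Nat.sub_self]⟩

/-- `w = ∏ x_i y_i`. -/
def wPoly (k : ℕ) : PolyRing k :=
  ∏ i, MvPolynomial.X (Sum.inl i) * MvPolynomial.X (Sum.inr i)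

theorem wPoly_eq : wPoly k =
    MvPolynomial.monomial (Finsupp.equivFunOnFinite.symm fun _ => 1) 1 := by
  rw [wPoly, Finset.prod_mul_distrib, ← Fintype.prod_sumElim, MvPolynomial.monomial_eq,
    Finsupp.prod_fintype _ _ (by simp)]
  simp

/-- Translates every monomial so that its smallest exponent is `0`. -/
def nrm (k : ℕ) : PolyRing k →ₗ[ℂ] PolyRing k :=
  ofMonomials fun e => MvPolynomial.monomial (nrmExp e) 1

theorem wPoly_pow_mul_monomial (e : Fin k ⊕ Fin k →₀ ℕ) :
    wPoly k ^ minExp e * MvPolynomial.monomial (nrmExp e) 1 = MvPolynomial.monomial e 1 := by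
  rw [wPoly_eq, MvPolynomial.monomial_pow, MvPolynomial.monomial_mul, one_pow, one_mul]
  congr 2
  refine Finsupp.ext fun i => ?_
  have := minExp_le e i
  simp [nrmExp_apply]
  omega

theorem dvd_sub_nrm (P : PolyRing k) : wPoly k - 1 ∣ P - nrm k P := by
  have hmon : ∀ e : Fin k ⊕ Fin k →₀ ℕ, wPoly k - 1 ∣
      MvPolynomial.monomial e 1 - nrm k (MvPolynomial.monomial e 1) := fun e => by
    rw [nrm, ofMonomials_monomial, ← wPoly_pow_mul_monomial e]
    have := sub_one_dvd_pow_sub_one (wPoly k) (minExp e)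
    rw [← sub_one_mul]
    exact this.mul_right _
  rw [← Ideal.Quotient.eq_zero_iff_dvd, map_sub, sub_eq_zero]
  exact ext_monomial_one
    (f := (Ideal.Quotient.mkₐ ℂ (Ideal.span {wPoly k - 1})).toLinearMap)
    (g := (Ideal.Quotient.mkₐ ℂ (Ideal.span {wPoly k - 1})).toLinearMap.comp (nrm k))
    (fun e => by
      have := hmon e
      rwa [← Ideal.Quotient.eq_zero_iff_dvd, map_sub, sub_eq_zero] at this) P

theorem phi_wPoly_mul (α : ℕ → ℂ) (Q : PolyRing k) (n : ℕ) :
    phi α (wPoly k * Q) n = phi α Q (n + 1) := by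
  refine ext_monomial_one
    (f := (LinearMap.proj n).comp ((phi α).comp (LinearMap.mulLeft ℂ (wPoly k))))
    (g := (LinearMap.proj (n + 1)).comp (phi α)) (fun e => ?_) Q
  simp only [LinearMap.comp_apply, LinearMap.proj_apply, LinearMap.mulLeft_apply]
  rw [wPoly_eq, MvPolynomial.monomial_mul, one_mul, phi_monomial, phi_monomial]
  refine Finset.prod_congr rfl fun i _ => ?_
  simp [add_assoc]

/-- Multiplication by `w` raises every exponent by one, hence advances `n` by one, so the sum
telescopes. -/
theorem sum_phi_wPoly_sub_one_mul (α : ℕ → ℂ) (Q : PolyRing k) (M : ℕ) :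
    ∑ j ∈ Finset.range M, phi α ((wPoly k - 1) * Q) j = phi α Q M - phi α Q 0 := by
  rw [← Finset.sum_range_sub]
  refine Finset.sum_congr rfl fun j _ => ?_
  rw [sub_mul, one_mul, map_sub, Pi.sub_apply, phi_wPoly_mul]

theorem phi_eq_ofMonomials (α : ℕ → ℂ) (P : PolyRing k) (n : ℕ) : phi α P n =
    ∑ e ∈ P.support, P.coeff e * ∏ i, α (n + e (Sum.inl i)) * conj (α (n + e (Sum.inr i))) := by
  have := ofMonomials_apply (fun (e : Fin k ⊕ Fin k →₀ ℕ) (n : ℕ) =>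
    ∏ i, α (n + e (Sum.inl i)) * conj (α (n + e (Sum.inr i)))) P
  have h2 := congrFun this n
  rw [Finset.sum_apply] at h2
  exact h2

theorem norm_phi_le (α : ℕ → ℂ) (hα : ∀ n, ‖α n‖ < 1) (P : PolyRing k) (n : ℕ) :
    ‖phi α P n‖ ≤ ∑ e ∈ P.support, ‖P.coeff e‖ := by
  rw [phi_eq_ofMonomials]
  refine norm_sum_le_of_le _ fun e _ => ?_
  rw [norm_mul]
  refine mul_le_of_le_one_right (norm_nonneg _) (norm_prod_le_one _ _ fun i _ => ?_)
  rw [norm_mul, RCLike.norm_conj]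
  exact mul_le_one₀ (hα _).le (norm_nonneg _) (hα _).le

/-- The partial sums of `f` are bounded. -/
def SumsBounded (f : ℕ → ℂ) : Prop := ∃ C : ℝ, ∀ M, ‖∑ j ∈ Finset.range M, f j‖ ≤ C

theorem SumsBounded.add {f g : ℕ → ℂ} (hf : SumsBounded f) (hg : SumsBounded g) :
    SumsBounded (f + g) := by
  obtain ⟨C, hC⟩ := hf
  obtain ⟨C', hC'⟩ := hg
  refine ⟨C + C', fun M => ?_⟩
  simp only [Pi.add_apply, Finset.sum_add_distrib]
  exact (norm_add_le _ _).trans (add_le_add (hC M) (hC' M))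

theorem SumsBounded.const_mul {f : ℕ → ℂ} (c : ℂ) (hf : SumsBounded f) :
    SumsBounded fun n => c * f n := by
  obtain ⟨C, hC⟩ := hf
  refine ⟨‖c‖ * C, fun M => ?_⟩
  rw [← Finset.mul_sum, norm_mul]
  exact mul_le_mul_of_nonneg_left (hC M) (norm_nonneg c)

theorem SumsBounded.sub {f g : ℕ → ℂ} (hf : SumsBounded f) (hg : SumsBounded g) :
    SumsBounded (f - g) := by
  have := hf.add (hg.const_mul (-1))
  convert this using 1
  funext n
  simp [sub_eq_add_neg]

theorem SumsBounded.sum {ι : Type*} (s : Finset ι) (f : ι → ℕ → ℂ)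
    (h : ∀ i ∈ s, SumsBounded (f i)) : SumsBounded (∑ i ∈ s, f i) :=
  Finset.sum_induction f SumsBounded (fun _ _ => SumsBounded.add) ⟨0, by simp⟩ h

theorem sumsBounded_phi_of_dvd (α : ℕ → ℂ) (hα : ∀ n, ‖α n‖ < 1) {P : PolyRing k}
    (h : wPoly k - 1 ∣ P) : SumsBounded (phi α P) := by
  obtain ⟨R, rfl⟩ := h
  refine ⟨(∑ e ∈ R.support, ‖R.coeff e‖) + ∑ e ∈ R.support, ‖R.coeff e‖, fun M => ?_⟩
  rw [sum_phi_wPoly_sub_one_mul]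
  exact (norm_sub_le _ _).trans (add_le_add (norm_phi_le α hα R _) (norm_phi_le α hα R _))

/-- Otherwise the sum over `M` periods would grow linearly in `M`. -/
theorem sum_period_eq_zero {f : ℕ → ℂ} {L : ℕ} (hp : ∀ n, f (n + L) = f n) (hf : SumsBounded f) :
    ∑ j ∈ Finset.range L, f j = 0 := by
  obtain ⟨C, hC⟩ := hf
  have hmul : ∀ M : ℕ, ∑ j ∈ Finset.range (M * L), f j = M * ∑ j ∈ Finset.range L, f j := fun M => by
    induction M with
    | zero => simp
    | succ M ih =>
      rw [Nat.succ_mul, Finset.sum_range_add, ih]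
      have : ∀ n, f (M * L + n) = f n := fun n => by
        clear ih
        induction M with
        | zero => simp
        | succ M ih => rw [Nat.succ_mul, add_right_comm, hp, ih]
      simp only [this]
      push_cast
      ring
  by_contra hne
  have hpos := norm_pos_iff.2 hne
  obtain ⟨M, hM⟩ := exists_nat_gt (C / ‖∑ j ∈ Finset.range L, f j‖)
  have := hC (M * L)
  rw [hmul, norm_mul, Complex.norm_natCast] at this
  rw [div_lt_iff₀ hpos] at hM
  linarith

theorem phi_nrm (α : ℕ → ℂ) (P : PolyRing k) (n : ℕ) : phi α (nrm k P) n =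
    ∑ e ∈ P.support, P.coeff e *
      ∏ i, α (n + nrmExp e (Sum.inl i)) * conj (α (n + nrmExp e (Sum.inr i))) := by
  rw [nrm, ofMonomials_apply]
  simp only [map_sum, map_smul, Finset.sum_apply, Pi.smul_apply, smul_eq_mul, phi_monomial]

theorem prod_conj_eq_zero {α : ℕ → ℂ} {n : ℕ} {e : Fin k ⊕ Fin k →₀ ℕ} {i : Fin k ⊕ Fin k}
    (h : α (n + e i) = 0) :
    ∏ i, α (n + e (Sum.inl i)) * conj (α (n + e (Sum.inr i))) = 0 := by
  cases i with
  | inl i => exact Finset.prod_eq_zero (Finset.mem_univ i) (by rw [h, zero_mul])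
  | inr i => exact Finset.prod_eq_zero (Finset.mem_univ i) (by rw [h, map_zero, mul_zero])

theorem prod_conj_congr {α β : ℕ → ℂ} {n : ℕ} {e : Fin k ⊕ Fin k →₀ ℕ}
    (h : ∀ i, α (n + e i) = β (n + e i)) :
    ∏ i, α (n + e (Sum.inl i)) * conj (α (n + e (Sum.inr i))) =
      ∏ i, β (n + e (Sum.inl i)) * conj (β (n + e (Sum.inr i))) :=
  Finset.prod_congr rfl fun i _ => by rw [h, h]

theorem phi_congr_periodic {β : ℕ → ℂ} {L : ℕ} (hβ : ∀ n, β (n + L) = β n) (P : PolyRing k)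
    (n : ℕ) : phi β P (n + L) = phi β P n := by
  rw [phi_eq_ofMonomials, phi_eq_ofMonomials]
  refine Finset.sum_congr rfl fun e _ => ?_
  simp only [add_right_comm n L, hβ]

/-- Periodize the values `α_0, …, α_D` with `D` zeros between copies; the sum over one period
vanishes. Setting the first entry of each copy to zero changes only the term at `n = 0`: every
normalized monomial contains its index-`n` factor, so that term becomes zero. Subtracting the two
period sums leaves the value at `0`. -/
theorem phi_nrm_eq_zero (hk : 0 < k) (P : PolyRing k)
    (h : ∀ α : ℕ → ℂ, (∀ n, ‖α n‖ < 1) → SumsBounded (phi α P)) (α : ℕ → ℂ)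
    (hα : ∀ n, ‖α n‖ < 1) : phi α (nrm k P) 0 = 0 := by
  have hF : ∀ β : ℕ → ℂ, (∀ n, ‖β n‖ < 1) → SumsBounded (phi β (nrm k P)) := fun β hβ => by
    have := (h β hβ).sub (sumsBounded_phi_of_dvd β hβ (dvd_sub_nrm P))
    rwa [← map_sub, sub_sub_cancel] at this
  obtain ⟨D, hD⟩ : ∃ D, ∀ e ∈ P.support, ∀ i, nrmExp e i ≤ D := by
    refine ⟨∑ e ∈ P.support, ∑ i, nrmExp e i, fun e he i => ?_⟩
    exact (Finset.single_le_sum (f := fun i => nrmExp e i) (fun _ _ => Nat.zero_le _)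
      (Finset.mem_univ i)).trans (Finset.single_le_sum (f := fun e => ∑ i, nrmExp e i)
        (fun _ _ => Nat.zero_le _) he)
  -- A monomial starting at a position at most `D` reaches at most `2 D`, hence stops before the
  -- next copy.
  let L := 2 * D + 1
  let β : ℕ → ℂ := fun n => if n % L ≤ D then α (n % L) else 0
  let β' : ℕ → ℂ := fun n => if n % L = 0 then 0 else β n
  have hβ : ∀ n, ‖β n‖ < 1 := fun n => by
    simp only [β]; split_ifs <;> simp [hα]
  have hβ' : ∀ n, ‖β' n‖ < 1 := fun n => by
    simp only [β']; split_ifs <;> simp [hβ]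
  have hper : ∀ n, β (n + L) = β n := fun n => by simp only [β, Nat.add_mod_right]
  have hper' : ∀ n, β' (n + L) = β' n := fun n => by simp only [β', hper, Nat.add_mod_right]
  have hs := sum_period_eq_zero (phi_congr_periodic hper (nrm k P)) (hF β hβ)
  have hs' := sum_period_eq_zero (phi_congr_periodic hper' (nrm k P)) (hF β' hβ')
  rw [Finset.sum_range_succ'] at hs hs'
  have h0' : phi β' (nrm k P) 0 = 0 := by
    rw [phi_nrm]
    refine Finset.sum_eq_zero fun e _ => ?_
    obtain ⟨i, hi⟩ := exists_nrmExp_eq_zero hk e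
    rw [prod_conj_eq_zero (i := i) (by simp [hi, β']), mul_zero]
  have h0 : phi β (nrm k P) 0 = phi α (nrm k P) 0 := by
    rw [phi_nrm, phi_nrm]
    refine Finset.sum_congr rfl fun e he => ?_
    rw [prod_conj_congr fun i => ?_]
    have := hD e he i
    simp only [β]
    rw [Nat.mod_eq_of_lt (by omega), if_pos (by omega)]
  have hmid : ∑ j ∈ Finset.range (2 * D), phi β (nrm k P) (j + 1) =
      ∑ j ∈ Finset.range (2 * D), phi β' (nrm k P) (j + 1) := by
    refine Finset.sum_congr rfl fun j hj => ?_
    have hj := Finset.mem_range.1 hj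
    rw [phi_nrm, phi_nrm]
    refine Finset.sum_congr rfl fun e he => ?_
    congr 1
    -- Up to position `D` no monomial meets a multiple of `L`; beyond it, the factor at the starting
    -- position is zero for both sequences.
    by_cases hjD : j + 1 ≤ D
    · refine prod_conj_congr fun i => ?_
      have := hD e he i
      simp only [β']
      rw [if_neg]
      rw [Nat.mod_eq_of_lt (by omega)]
      omega
    · obtain ⟨i, hi⟩ := exists_nrmExp_eq_zero hk e
      have hb : β (j + 1) = 0 := by
        simp only [β]
        rw [Nat.mod_eq_of_lt (by omega), if_neg hjD]
      rw [prod_conj_eq_zero (i := i) (by rw [hi, add_zero, hb]),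
        prod_conj_eq_zero (i := i) (by rw [hi, add_zero]; simp only [β', hb, ite_self])]
  rw [← h0]
  rw [h0', ← hmid] at hs'
  linear_combination hs - hs'

theorem dvd_symm {P : PolyRing k} (h : wPoly k - 1 ∣ P) : wPoly k - 1 ∣ symm k P := by
  rw [symm_apply]
  refine Finset.dvd_sum fun σ _ => Finset.dvd_sum fun τ _ => ?_
  have hw : MvPolynomial.rename (Sum.map σ τ) (wPoly k - 1) = wPoly k - 1 := by
    rw [map_sub, map_one, wPoly, Finset.prod_mul_distrib, map_mul, map_prod, map_prod]
    simp only [MvPolynomial.rename_X, Sum.map_inl, Sum.map_inr]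
    rw [Equiv.prod_comp σ fun i => (MvPolynomial.X (Sum.inl i) : PolyRing k),
      Equiv.prod_comp τ fun i => (MvPolynomial.X (Sum.inr i) : PolyRing k)]
  have := map_dvd (MvPolynomial.rename (Sum.map σ τ)) h
  rwa [hw] at this

/-- This is the converse, after symmetrization, of `sumsBounded_phi_of_dvd`, and it is the source of
uniqueness. -/
theorem dvd_symm_of_sumsBounded (hk : 0 < k) (P : PolyRing k)
    (h : ∀ α : ℕ → ℂ, (∀ n, ‖α n‖ < 1) → SumsBounded (phi α P)) : wPoly k - 1 ∣ symm k P := by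
  have h1 := symm_eq_zero_of_phi_eq_zero (nrm k P) (phi_nrm_eq_zero hk P h)
  have h2 := dvd_symm (dvd_sub_nrm P)
  rwa [map_sub, h1, sub_zero] at h2

end Normalize

/-! ### Exponents of one monomial differ by at most `l`. -/

section Spread

variable {k l d : ℕ}

/-- Each exponent is a tail sum of `ν` plus a head sum of `μ`. For any two of them either the tails
or the heads are nested, and the other sum is at most `l`. -/
theorem sum_add_sum_le {ν μ : Fin k →₀ ℕ} (hν : ν ∈ weakComps k l) (hμ : μ ∈ weakComps k l)
    {U U' D D' : Finset (Fin k)} (h : U ⊆ U' ∨ D ⊆ D') :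
    ∑ i ∈ U, ν i + ∑ i ∈ D, μ i ≤ ∑ i ∈ U', ν i + ∑ i ∈ D', μ i + l := by
  have h1 := sum_le_of_mem_weakComps hν U
  have h2 := sum_le_of_mem_weakComps hμ D
  rcases h with h | h
  · have := Finset.sum_le_sum_of_subset (f := ν) h
    omega
  · have := Finset.sum_le_sum_of_subset (f := μ) h
    omega

theorem expPos_le_add {ν μ : Fin k →₀ ℕ} (hν : ν ∈ weakComps k l) (hμ : μ ∈ weakComps k l)
    (i j : Fin k ⊕ Fin k) : expPos ν μ i ≤ expPos ν μ j + l := by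
  rcases i with s | s <;> rcases j with t | t <;> refine sum_add_sum_le hν hμ ?_ <;>
    rcases le_or_gt t s with h | h
  all_goals first
    | exact Or.inl fun a ha => by simp only [Finset.mem_Ici] at *; omega
    | exact Or.inr fun a ha => by simp only [Finset.mem_Iio, Finset.mem_Iic] at *; omega

theorem expNeg_le_add {ν μ : Fin k →₀ ℕ} (hν : ν ∈ weakComps k l) (hμ : μ ∈ weakComps k l)
    (i j : Fin k ⊕ Fin k) : expNeg ν μ i ≤ expNeg ν μ j + l := by
  rcases i with s | s <;> rcases j with t | t <;> refine sum_add_sum_le hν hμ ?_ <;>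
    rcases lt_trichotomy t s with h | h | h
  all_goals first
    | exact Or.inl fun a ha => by simp only [Finset.mem_Ici, Finset.mem_Ioi] at *; omega
    | exact Or.inr fun a ha => by simp only [Finset.mem_Iio] at *; omega

end Spread

/-! ### The explicit local polynomial. -/

section LocalPoly

variable {k d : ℕ}

/-- Truncation of `ℕ` to `{0, …, d}`. -/
def clamp (d n : ℕ) : Fin (d + 1) := ⟨min n d, by omega⟩

/-- Evaluation of local polynomials as a linear map. -/
def localEval (α : ℕ → ℂ) (n : ℕ) : LocalPoly d →ₗ[ℂ] ℂ :=
  (MvPolynomial.aeval (Sum.elim (fun i : Fin (d + 1) => α (n + i))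
    (fun i : Fin (d + 1) => conj (α (n + i))))).toLinearMap

theorem localEval_apply (α : ℕ → ℂ) (n : ℕ) (G : LocalPoly d) :
    localEval α n G = localValue G α n := rfl

/-- The spread bound puts all normalized exponents in `{0, …, d}`, so the truncation `clamp` does
nothing. -/
theorem localValue_encode_nrm_monomial {e : Fin k ⊕ Fin k →₀ ℕ} (he : ∀ i j, e i ≤ e j + d)
    (α : ℕ → ℂ) (n : ℕ) :
    localValue (encode (clamp d) (nrm k (MvPolynomial.monomial e 1))) α n =
      phi α (nrm k (MvPolynomial.monomial e 1)) n := by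
  have h : ∀ i, ((clamp d (nrmExp e i) : Fin (d + 1)) : ℕ) = nrmExp e i := fun i => by
    have hk : 0 < k := by rcases i with i | i <;> exact i.pos
    obtain ⟨j, hj⟩ := exists_eq_minExp hk e
    have := he i j
    rw [nrmExp_apply]
    simp only [clamp]
    omega
  rw [nrm, ofMonomials_monomial, encode, ofMonomials_monomial, phi_monomial, localValue,
    eval_monomial_codeExp]
  simp only [h]

variable {K : ℕ} (θ : Fin K → ℝ) (m : Fin K → ℕ)

/-- The part of degree `2k` of a local polynomial for `Tr V(U_N)`. -/
def localMain (k : ℕ) : LocalPoly (order m) := encode (clamp (order m)) (nrm k (polyMain θ m k))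

theorem localValue_localMain (α : ℕ → ℂ) (n : ℕ) :
    localValue (localMain θ m k) α n = phi α (nrm k (polyMain θ m k)) n := by
  let f := (localEval α n).comp ((encode (clamp (order m))).comp (nrm k))
  let g := (LinearMap.proj n).comp ((phi α).comp (nrm k))
  have hmem : polyMain θ m k ∈ LinearMap.eqLocus f g := by
    refine Submodule.smul_mem _ _ (Submodule.sum_mem _ fun l hl => ?_)
    have hl := (Finset.mem_Icc.1 hl).2
    refine Submodule.add_mem _ (Submodule.smul_mem _ _ ?_) (Submodule.smul_mem _ _ ?_)
    · refine Submodule.sum_mem _ fun ν hν => Submodule.sum_mem _ fun μ hμ => ?_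
      refine localValue_encode_nrm_monomial (fun i j => ?_) α n
      exact (expPos_le_add (mem_weakComps_of_mem_comps hν) hμ i j).trans (by omega)
    · refine Submodule.sum_mem _ fun ν hν => Submodule.sum_mem _ fun μ hμ => ?_
      refine localValue_encode_nrm_monomial (fun i j => ?_) α n
      exact (expNeg_le_add (mem_weakComps_of_mem_comps hν) hμ i j).trans (by omega)
  exact hmem

theorem polyMain_eq_zero (h : order m < k) : polyMain θ m k = 0 := by
  rw [polyMain, Finset.sum_eq_zero, smul_zero]
  intro l hl
  have hl := (Finset.mem_Icc.1 hl).2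
  rw [polyPos, polyNeg, comps_eq_empty (by omega)]
  simp

theorem sum_codeExp_inl {ι : Type*} [Fintype ι] (g : ℕ → ι) (e : Fin k ⊕ Fin k →₀ ℕ) :
    ∑ i, codeExp g e (Sum.inl i) = k := by
  classical
  simp only [codeExp, Finsupp.finsetSum_apply, Finsupp.add_apply, Finsupp.single_apply]
  rw [Finset.sum_comm]
  simp

theorem sum_codeExp_inr {ι : Type*} [Fintype ι] (g : ℕ → ι) (e : Fin k ⊕ Fin k →₀ ℕ) :
    ∑ i, codeExp g e (Sum.inr i) = k := by
  classical
  simp only [codeExp, Finsupp.finsetSum_apply, Finsupp.add_apply, Finsupp.single_apply]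
  rw [Finset.sum_comm]
  simp

theorem encode_induction {ι : Type*} {g : ℕ → ι} {p : MvPolynomial (ι ⊕ ι) ℂ → Prop}
    (hadd : ∀ P Q, p P → p Q → p (P + Q)) (h0 : p 0)
    (hmon : ∀ (c : ℂ) (e : Fin k ⊕ Fin k →₀ ℕ), p (MvPolynomial.monomial (codeExp g e) c))
    (P : PolyRing k) : p (encode g P) := by
  rw [encode, ofMonomials_apply]
  refine Finset.sum_induction _ p hadd h0 fun e _ => ?_
  rw [MvPolynomial.smul_monomial]
  exact hmon _ e

theorem isHomogeneous_encode {ι : Type*} [Fintype ι] (g : ℕ → ι) (P : PolyRing k) :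
    (encode g P).IsHomogeneous (2 * k) := by
  refine encode_induction (p := fun F => F.IsHomogeneous (2 * k))
    (fun P Q => MvPolynomial.IsHomogeneous.add) (MvPolynomial.isHomogeneous_zero _ _ _) (fun c e => ?_) P
  refine MvPolynomial.isHomogeneous_monomial _ ?_
  rw [Finsupp.degree_eq_sum, Fintype.sum_sum_type, sum_codeExp_inl, sum_codeExp_inr, two_mul]

theorem Balanced.add {G G' : LocalPoly d} (h : Balanced G) (h' : Balanced G') :
    Balanced (G + G') := fun e he => by
  rcases Finset.mem_union.1 (MvPolynomial.support_add he) with he | he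
  · exact h e he
  · exact h' e he

theorem balanced_zero : Balanced (0 : LocalPoly d) := fun e he => by simp at he

theorem balanced_encode (g : ℕ → Fin (d + 1)) (P : PolyRing k) : Balanced (encode g P) := by
  refine encode_induction (fun P Q => Balanced.add) balanced_zero (fun c e e' he' => ?_) P
  rw [Finset.mem_singleton.1 (MvPolynomial.support_monomial_subset he'), sum_codeExp_inl,
    sum_codeExp_inr]

/-- A local polynomial for `Tr V(U_N)`. -/
def localTrace : LocalPoly (order m) := ∑ k ∈ Finset.range (order m), localMain θ m (k + 1)

theorem balanced_localTrace : Balanced (localTrace θ m) :=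
  Finset.sum_induction _ Balanced (fun _ _ => Balanced.add) balanced_zero
    fun _ _ => balanced_encode _ _

theorem totalDegree_localTrace_le : (localTrace θ m).totalDegree ≤ 2 * order m := by
  refine MvPolynomial.totalDegree_finsetSum_le fun k hk => ?_
  refine (isHomogeneous_encode _ _).totalDegree_le.trans ?_
  have := Finset.mem_range.1 hk
  omega

theorem homogeneousComponent_localTrace (hk : 0 < k) :
    MvPolynomial.homogeneousComponent (2 * k) (localTrace θ m) = localMain θ m k := by
  obtain ⟨k, rfl⟩ := Nat.exists_eq_succ_of_ne_zero hk.ne'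
  rw [localTrace, map_sum]
  have h : ∀ k', MvPolynomial.homogeneousComponent (2 * (k + 1)) (localMain θ m (k' + 1)) =
      if k' = k then localMain θ m (k' + 1) else 0 := fun k' => by
    rw [localMain, MvPolynomial.homogeneousComponent_of_mem
      ((MvPolynomial.mem_homogeneousSubmodule _ _).2 (isHomogeneous_encode _ _))]
    exact if_congr (by omega) rfl rfl
  simp only [Nat.succ_eq_add_one, h]
  rw [Finset.sum_ite_eq']
  split_ifs with hkd
  · rfl
  · rw [localMain, polyMain_eq_zero θ m (by rw [Finset.mem_range] at hkd; omega), map_zero,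
      map_zero]

end LocalPoly

/-! ### The explicit local polynomial is admissible. -/

section TraceLocal

variable {K : ℕ} (θ : Fin K → ℝ) (m : Fin K → ℕ) (α : ℕ → ℂ)

/-- The partial sums of `phi` as a linear functional. -/
def phiSum (k N : ℕ) : PolyRing k →ₗ[ℂ] ℂ :=
  ∑ j ∈ Finset.range N, (LinearMap.proj j).comp (phi α)

theorem phiSum_apply (k N : ℕ) (P : PolyRing k) :
    phiSum α k N P = ∑ j ∈ Finset.range N, phi α P j := by
  simp [phiSum, LinearMap.sum_apply]

theorem trace_vMatrix {N : ℕ} (U : Matrix (Fin N) (Fin N) ℂ) : (vMatrix θ m U).trace =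
    ∑ l ∈ Finset.Icc 1 (order m), ((-1 / (zH θ m : ℂ) * (hCoeff θ m l / l)) * (U ^ l).trace +
      (-1 / (zH θ m : ℂ) * (hCoeff θ m (-l) / l)) * (U.conjTranspose ^ l).trace) := by
  rw [vMatrix, Matrix.trace_smul, Matrix.trace_sum, smul_eq_mul, Finset.mul_sum]
  refine Finset.sum_congr rfl fun l _ => ?_
  rw [Matrix.trace_add, Matrix.trace_smul, Matrix.trace_smul, smul_eq_mul, smul_eq_mul]
  ring

theorem sum_range_eq_of_le {l d : ℕ} (hl : l ≤ d) (f : ℕ → ℂ) (hf : ∀ k, l ≤ k → f k = 0) :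
    ∑ k ∈ Finset.range l, f k = ∑ k ∈ Finset.range d, f k :=
  Finset.sum_subset (fun k hk => Finset.mem_range.2 ((Finset.mem_range.1 hk).trans_le hl))
    fun k _ hk => hf k (by simpa using hk)

/-- The factor `1/l` in `V` cancels the `l` of the trace expansion and leaves the prefactor of
`polyMain`. The range of `k` can be extended to `d` because `l` has no composition into more than
`l` positive parts. -/
theorem sum_phiSum_polyMain (N : ℕ) :
    ∑ k ∈ Finset.range (order m), phiSum α (k + 1) N (polyMain θ m (k + 1)) =
    ∑ l ∈ Finset.Icc 1 (order m), ((-1 / (zH θ m : ℂ) * (hCoeff θ m l / l)) *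
        ∑ k ∈ Finset.range l, (-1) ^ (k + 1) * ((l : ℂ) / ((k : ℂ) + 1)) *
          ∑ j ∈ Finset.range N, phi α (polyPos (k + 1) l) j +
      (-1 / (zH θ m : ℂ) * (hCoeff θ m (-l) / l)) *
        ∑ k ∈ Finset.range l, (-1) ^ (k + 1) * ((l : ℂ) / ((k : ℂ) + 1)) *
          ∑ j ∈ Finset.range N, phi α (polyNeg (k + 1) l) j) := by
  have hpos : ∀ l ∈ Finset.Icc 1 (order m), ∑ k ∈ Finset.range l,
      (-1) ^ (k + 1) * ((l : ℂ) / ((k : ℂ) + 1)) * ∑ j ∈ Finset.range N, phi α (polyPos (k + 1) l) j =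
      ∑ k ∈ Finset.range (order m), (-1) ^ (k + 1) * ((l : ℂ) / ((k : ℂ) + 1)) *
        phiSum α (k + 1) N (polyPos (k + 1) l) := fun l hl => by
    simp only [← phiSum_apply]
    refine sum_range_eq_of_le (Finset.mem_Icc.1 hl).2 _ fun k hk => ?_
    rw [polyPos, comps_eq_empty (by omega)]
    simp
  have hneg : ∀ l ∈ Finset.Icc 1 (order m), ∑ k ∈ Finset.range l,
      (-1) ^ (k + 1) * ((l : ℂ) / ((k : ℂ) + 1)) * ∑ j ∈ Finset.range N, phi α (polyNeg (k + 1) l) j =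
      ∑ k ∈ Finset.range (order m), (-1) ^ (k + 1) * ((l : ℂ) / ((k : ℂ) + 1)) *
        phiSum α (k + 1) N (polyNeg (k + 1) l) := fun l hl => by
    simp only [← phiSum_apply]
    refine sum_range_eq_of_le (Finset.mem_Icc.1 hl).2 _ fun k hk => ?_
    rw [polyNeg, comps_eq_empty (by omega)]
    simp
  conv_rhs => rw [Finset.sum_congr rfl fun l hl => by rw [hpos l hl, hneg l hl]]
  simp only [polyMain, map_smul, map_sum, map_add, smul_eq_mul, Finset.mul_sum,
    ← Finset.sum_add_distrib]
  rw [Finset.sum_comm]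
  refine Finset.sum_congr rfl fun l hl => Finset.sum_congr rfl fun k _ => ?_
  have hl0 : (l : ℂ) ≠ 0 := by
    have := (Finset.mem_Icc.1 hl).1
    exact_mod_cast (by omega : l ≠ 0)
  have hk0 : (k : ℂ) + 1 ≠ 0 := by exact_mod_cast k.succ_ne_zero
  by_cases hZ : (zH θ m : ℂ) = 0
  · simp [hZ]
  · push_cast
    field_simp
    ring

/-- Passing to the normalized form costs a telescoping sum, and dropping the last `d` positions
costs at most `d` bounded terms. -/
theorem exists_norm_phiSum_sub_le (hα : ∀ n, ‖α n‖ < 1) {k : ℕ} (P : PolyRing k) (d : ℕ) :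
    ∃ C : ℝ, ∀ N, ‖phiSum α k N P - phiSum α k (N - d) (nrm k P)‖ ≤ C := by
  obtain ⟨C, hC⟩ := sumsBounded_phi_of_dvd α hα (dvd_sub_nrm P)
  refine ⟨C + d * ∑ e ∈ P.support, ‖P.coeff e‖, fun N => ?_⟩
  have h1 := hC (N - d)
  rw [← phiSum_apply, map_sub] at h1
  have h2 : ‖phiSum α k N P - phiSum α k (N - d) P‖ ≤ d * ∑ e ∈ P.support, ‖P.coeff e‖ := by
    rw [phiSum_apply, phiSum_apply, ← Finset.sum_range_add_sum_Ico _ (Nat.sub_le N d),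
      add_sub_cancel_left]
    refine (norm_sum_le_of_le _ fun j _ => norm_phi_le α hα P j).trans ?_
    rw [Finset.sum_const, Nat.card_Ico, nsmul_eq_mul]
    refine mul_le_mul_of_nonneg_right ?_ (Finset.sum_nonneg fun _ _ => norm_nonneg _)
    exact_mod_cast (by omega : N - (N - d) ≤ d)
  have := norm_add_le (phiSum α k (N - d) P - phiSum α k (N - d) (nrm k P))
    (phiSum α k N P - phiSum α k (N - d) P)
  rw [show phiSum α k (N - d) P - phiSum α k (N - d) (nrm k P) +
    (phiSum α k N P - phiSum α k (N - d) P) =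
    phiSum α k N P - phiSum α k (N - d) (nrm k P) by ring] at this
  linarith

theorem isTraceLocal_localTrace : IsTraceLocal θ m (localTrace θ m) := by
  refine ⟨balanced_localTrace θ m, fun α hα => ?_⟩
  obtain ⟨C₁, h₁⟩ : ∃ C : ℝ, ∀ N, ‖(vMatrix θ m (ggt α N)).trace -
      ∑ k ∈ Finset.range (order m), phiSum α (k + 1) N (polyMain θ m (k + 1))‖ ≤ C := by
    simp only [sum_phiSum_polyMain, trace_vMatrix, Finset.sum_add_distrib]
    obtain ⟨C, hC⟩ := exists_norm_sum_mul_sub_le (Finset.Icc 1 (order m))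
      (fun l => -1 / (zH θ m : ℂ) * (hCoeff θ m l / l)) _ _ fun l hl =>
        exists_norm_trace_ggt_pow_sub_le α hα (Finset.mem_Icc.1 hl).1
    obtain ⟨C', hC'⟩ := exists_norm_sum_mul_sub_le (Finset.Icc 1 (order m))
      (fun l => -1 / (zH θ m : ℂ) * (hCoeff θ m (-l) / l)) _ _ fun l hl =>
        exists_norm_trace_conjTranspose_ggt_pow_sub_le α hα (Finset.mem_Icc.1 hl).1
    refine ⟨C + C', fun N => ?_⟩
    rw [add_sub_add_comm]
    exact (norm_add_le _ _).trans (add_le_add (hC N) (hC' N))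
  obtain ⟨C₂, h₂⟩ := exists_norm_sum_mul_sub_le (Finset.range (order m)) (fun _ => 1)
    (fun k N => phiSum α (k + 1) N (polyMain θ m (k + 1)))
    (fun k N => phiSum α (k + 1) (N - order m) (nrm (k + 1) (polyMain θ m (k + 1))))
    fun k _ => exists_norm_phiSum_sub_le α hα _ _
  refine ⟨C₁ + C₂, fun N => ?_⟩
  have h3 : ∑ j ∈ Finset.range (N - order m), localValue (localTrace θ m) α j =
      ∑ k ∈ Finset.range (order m),
        phiSum α (k + 1) (N - order m) (nrm (k + 1) (polyMain θ m (k + 1))) := by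
    simp only [← localEval_apply, localTrace, map_sum]
    simp only [localEval_apply, localValue_localMain, phiSum_apply]
    exact Finset.sum_comm
  have h₂' := h₂ N
  simp only [one_mul] at h₂'
  rw [h3, ← sub_add_sub_cancel]
  exact (norm_add_le _ _).trans (add_le_add (h₁ N) h₂')

end TraceLocal

/-! ### Homogeneous parts and their representatives. -/

section Homogeneous

variable {k d : ℕ}

theorem localValue_scale {F : LocalPoly d} {i : ℕ} (hF : F.IsHomogeneous i) (t : ℝ) (α : ℕ → ℂ)
    (n : ℕ) : localValue F (fun j => t * α j) n = (t : ℂ) ^ i * localValue F α n := by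
  have hfun : (Sum.elim (fun i : Fin (d + 1) => (t : ℂ) * α (n + i))
      (fun i : Fin (d + 1) => conj ((t : ℂ) * α (n + i)))) = fun s => (t : ℂ) *
      (Sum.elim (fun i : Fin (d + 1) => α (n + i))
        (fun i : Fin (d + 1) => conj (α (n + i)))) s := by
    funext s
    cases s <;> simp
  simp only [localValue]
  rw [hfun, MvPolynomial.eval_eq', MvPolynomial.eval_eq', Finset.mul_sum]
  refine Finset.sum_congr rfl fun e he => ?_
  have hdeg : ∑ s, e s = i := by
    by_contra hne
    rw [← Finsupp.degree_eq_sum] at hne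
    exact (MvPolynomial.mem_support_iff.1 he) (hF.coeff_eq_zero hne)
  simp only [mul_pow, Finset.prod_mul_distrib, Finset.prod_pow_eq_pow_sum, hdeg]
  ring

/-- The disk is stable under scaling by `t` in `(0, 1)`. Inverting a Vandermonde matrix writes the
component as a combination of scaled copies of `G`. -/
theorem sumsBounded_homogeneousComponent (G : LocalPoly d)
    (h : ∀ α : ℕ → ℂ, (∀ n, ‖α n‖ < 1) → SumsBounded (localValue G α)) (i : ℕ) (α : ℕ → ℂ)
    (hα : ∀ n, ‖α n‖ < 1) :
    SumsBounded (localValue (MvPolynomial.homogeneousComponent i G) α) := by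
  let D := G.totalDegree
  by_cases hi : D < i
  · rw [MvPolynomial.homogeneousComponent_eq_zero _ _ hi]
    exact ⟨0, fun M => by simp [localValue]⟩
  let t : Fin (D + 1) → ℝ := fun j => 1 / ((j : ℝ) + 2)
  have ht0 : ∀ j, 0 < t j := fun j => by positivity
  have ht1 : ∀ j, t j < 1 := fun j => by
    simp only [t]
    rw [div_lt_one (by positivity)]
    have : (0 : ℝ) ≤ (j : ℕ) := Nat.cast_nonneg _
    linarith
  have htinj : Function.Injective fun j => (t j : ℂ) := fun j j' hj => by
    have hj : t j = t j' := Complex.ofReal_injective hj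
    simp only [t, one_div, inv_inj, add_left_inj, Nat.cast_inj] at hj
    exact Fin.ext hj
  let V := Matrix.vandermonde fun j => (t j : ℂ)
  have hV : V⁻¹ * V = 1 := Matrix.nonsing_inv_mul _
    (Matrix.det_vandermonde_ne_zero_iff.2 htinj).isUnit
  let i' : Fin (D + 1) := ⟨i, by omega⟩
  have hexp : ∀ j n, localValue G (fun n => t j * α n) n = ∑ a : Fin (D + 1),
      V j a * localValue (MvPolynomial.homogeneousComponent a G) α n := fun j n => by
    have hG := MvPolynomial.sum_homogeneousComponent G
    conv_lhs => rw [← hG, ← localEval_apply, map_sum]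
    rw [Finset.sum_range]
    refine Finset.sum_congr rfl fun a _ => ?_
    rw [localEval_apply, localValue_scale (MvPolynomial.homogeneousComponent_isHomogeneous _ _)]
    rfl
  have hcomb : localValue (MvPolynomial.homogeneousComponent i G) α =
      ∑ j, fun n => V⁻¹ i' j * localValue G (fun n => t j * α n) n := by
    funext n
    rw [Finset.sum_apply]
    simp only [hexp, Finset.mul_sum, ← mul_assoc]
    rw [Finset.sum_comm]
    simp only [← Finset.sum_mul, ← Matrix.mul_apply, hV]
    rw [Finset.sum_eq_single i']
    · simp [i']
    · intro b _ hb
      rw [Matrix.one_apply_ne hb.symm, zero_mul]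
    · simp
  rw [hcomb]
  refine SumsBounded.sum _ _ fun j _ => (h _ fun n => ?_).const_mul _
  rw [norm_mul, Complex.norm_real, Real.norm_of_nonneg (ht0 j).le]
  exact mul_lt_one_of_nonneg_of_lt_one_left (ht0 j).le (ht1 j) (hα n).le

theorem exists_prod_eq_prod_pow {ι : Type*} [Fintype ι] (e : ι → ℕ) (h : ∑ i, e i = k) :
    ∃ β : Fin k → ι, ∀ f : ι → ℂ, ∏ j, f (β j) = ∏ i, f i ^ e i := by
  have hcard : Fintype.card (Fin k) = Fintype.card (Σ i, Fin (e i)) := by simp [h]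
  let E := Fintype.equivOfCardEq hcard
  refine ⟨fun j => (E j).1, fun f => ?_⟩
  rw [Equiv.prod_comp E fun p => f p.1, Fintype.prod_sigma]
  simp

/-- Balance and degree `2k` give each monomial exactly `k` factors of either kind; listing them in
some order supplies the exponents. -/
theorem exists_represents {G : LocalPoly d} (hG : Balanced G) (k : ℕ) :
    ∃ P : PolyRing k, Represents P (MvPolynomial.homogeneousComponent (2 * k) G) := by
  let F := MvPolynomial.homogeneousComponent (2 * k) G
  have hmon : ∀ e ∈ F.support, ∃ ε : Fin k ⊕ Fin k →₀ ℕ, ∀ (α : ℕ → ℂ) (n : ℕ),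
      phi α (MvPolynomial.monomial ε 1) n = localValue (MvPolynomial.monomial e 1) α n := by
    intro e he
    rw [MvPolynomial.support_homogeneousComponent, Finset.mem_filter] at he
    have hb := hG e he.1
    have hd := he.2
    rw [Finsupp.degree_eq_sum, Fintype.sum_sum_type] at hd
    obtain ⟨β, hβ⟩ := exists_prod_eq_prod_pow (fun i => e (Sum.inl i)) (by omega : _ = k)
    obtain ⟨γ, hγ⟩ := exists_prod_eq_prod_pow (fun i => e (Sum.inr i)) (by omega : _ = k)
    refine ⟨Finsupp.equivFunOnFinite.symm (Sum.elim (fun i => (β i : ℕ)) fun i => (γ i : ℕ)),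
      fun α n => ?_⟩
    rw [phi_monomial, Finset.prod_mul_distrib, localValue, MvPolynomial.eval_monomial, one_mul,
      Finsupp.prod_fintype _ _ (by simp), Fintype.prod_sum_type]
    simp only [Finsupp.coe_equivFunOnFinite_symm, Sum.elim_inl, Sum.elim_inr]
    rw [hβ fun i => α (n + i), hγ fun i => conj (α (n + i))]
  choose! ε hε using hmon
  refine ⟨∑ e ∈ F.support, F.coeff e • MvPolynomial.monomial (ε e) 1, fun α _ n => ?_⟩
  change _ = localValue F α n
  conv_rhs => rw [F.as_sum, ← localEval_apply, map_sum]
  rw [map_sum, Finset.sum_apply]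
  refine Finset.sum_congr rfl fun e he => ?_
  rw [map_smul, Pi.smul_apply, hε e he, ← localEval_apply, ← map_smul, MvPolynomial.smul_monomial,
    smul_eq_mul, mul_one]

end Homogeneous

/-! ### Comparison of an arbitrary admissible polynomial with the explicit one. -/

section Main

variable {K : ℕ} (θ : Fin K → ℝ) (m : Fin K → ℕ) {k : ℕ}

theorem IsTraceLocal.sumsBounded_sub {G G' : LocalPoly (order m)} (h : IsTraceLocal θ m G)
    (h' : IsTraceLocal θ m G') (α : ℕ → ℂ) (hα : ∀ n, ‖α n‖ < 1) :
    SumsBounded (localValue (G - G') α) := by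
  obtain ⟨C, hC⟩ := h.2 α hα
  obtain ⟨C', hC'⟩ := h'.2 α hα
  refine ⟨C' + C, fun M => ?_⟩
  -- At `N = M + d` the local sum has exactly `M` terms and the traces cancel.
  have h1 := hC (M + order m)
  have h2 := hC' (M + order m)
  rw [Nat.add_sub_cancel] at h1 h2
  simp only [← localEval_apply, map_sub, Finset.sum_sub_distrib] at h1 h2 ⊢
  have := norm_sub_le_of_le h2 h1
  rwa [sub_sub_sub_cancel_left] at this

/-- Both `G_{2k}` minus the explicit component and `polyMain` minus its normalized form have bounded
partial sums, so `dvd_symm_of_sumsBounded` applies to `P - polyMain`. -/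
theorem dvd_symm_sub_polyMain (hk : 0 < k) {G : LocalPoly (order m)} (hG : IsTraceLocal θ m G)
    {P : PolyRing k} (hP : Represents P (MvPolynomial.homogeneousComponent (2 * k) G)) :
    wPoly k - 1 ∣ symm k (P - polyMain θ m k) := by
  refine dvd_symm_of_sumsBounded hk _ fun α hα => ?_
  have h1 := sumsBounded_homogeneousComponent (G - localTrace θ m)
    (hG.sumsBounded_sub θ m (isTraceLocal_localTrace θ m)) (2 * k) α hα
  have h2 := sumsBounded_phi_of_dvd α hα (dvd_sub_nrm (polyMain θ m k))
  have h3 : phi α (P - polyMain θ m k) =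
      localValue (MvPolynomial.homogeneousComponent (2 * k) (G - localTrace θ m)) α -
        phi α (polyMain θ m k - nrm k (polyMain θ m k)) := by
    funext n
    simp only [Pi.sub_apply, map_sub, hP α hα n]
    rw [homogeneousComponent_localTrace θ m hk, ← localEval_apply α n (_ - _), map_sub,
      localEval_apply, localEval_apply, localValue_localMain]
    ring
  rw [h3]
  exact h1.sub h2

theorem algebraMap_wPoly_sub_one :
    algebraMap (PolyRing k) (RatField k) (wPoly k - 1) = wVar k - 1 := by
  rw [map_sub, map_one, wVar_eq_algebraMap, wPoly]

theorem sameImage_of_dvd {P Q : PolyRing k} (h : wPoly k - 1 ∣ P - Q) :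
    SameImage (algebraMap (PolyRing k) (RatField k) P) (algebraMap (PolyRing k) (RatField k) Q) := by
  obtain ⟨R, hR⟩ := h
  refine sameImage_iff.2 ⟨algebraMap_mem_laurentRing _, algebraMap_mem_laurentRing _, _,
    algebraMap_mem_laurentRing R, ?_⟩
  rw [← map_sub, hR, map_mul, algebraMap_wPoly_sub_one]

theorem SameImage.trans {f g h : RatField k} (h₁ : SameImage f g) (h₂ : SameImage g h) :
    SameImage f h := by
  rw [sameImage_iff] at *
  obtain ⟨hf, _, r, hr, e⟩ := h₁
  obtain ⟨_, hh, r', hr', e'⟩ := h₂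
  exact ⟨hf, hh, r + r', add_mem hr hr', by linear_combination e + e'⟩

theorem sameImage_polyMain_one (hk : 0 < k) (hZ : zH θ m ≠ 0) :
    SameImage (algebraMap (PolyRing k) (RatField k) (polyMain θ m k)) (gPrime xVar yVar θ m) := by
  have := sameImage_polyMain θ m hk hZ 1 1
  rw [Equiv.Perm.coe_one, Sum.map_id_id, MvPolynomial.rename_id] at this
  exact this

theorem exists_represents_sameImage (hk : 0 < k) (hZ : zH θ m ≠ 0) {G : LocalPoly (order m)}
    (hG : IsTraceLocal θ m G) :
    ∃ P : PolyRing k, Represents P (MvPolynomial.homogeneousComponent (2 * k) G) ∧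
      SameImage (algebraMap (PolyRing k) (RatField k) P) (gPrime xVar yVar θ m) := by
  obtain ⟨P₁, hP₁⟩ := exists_represents hG.1 k
  have hdvd := dvd_symm_sub_polyMain θ m hk hG hP₁
  let c : ℂ := ((k.factorial : ℂ) ^ 2)⁻¹
  have hc : c * (k.factorial : ℂ) ^ 2 = 1 := inv_mul_cancel₀ (by
    exact pow_ne_zero 2 (by exact_mod_cast k.factorial_ne_zero))
  -- Averaging over the `(k!)²` permutations does not change `φ`, so this still represents `G_{2k}`.
  -- The correction is divisible by `w - 1`, so its image is that of `polyMain`.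
  refine ⟨polyMain θ m k + c • symm k (P₁ - polyMain θ m k), fun α hα n => ?_, ?_⟩
  · rw [← hP₁ α hα n, map_add, map_smul, phi_symm, smul_smul, hc, one_smul, map_sub,
      add_sub_cancel]
  · refine SameImage.trans (sameImage_of_dvd ?_) (sameImage_polyMain_one θ m hk hZ)
    rw [add_sub_cancel_left, MvPolynomial.smul_eq_C_mul]
    exact hdvd.mul_left _

theorem sameImage_sum_perm (hk : 0 < k) (hZ : zH θ m ≠ 0) {G : LocalPoly (order m)}
    (hG : IsTraceLocal θ m G) {P : PolyRing k}
    (hP : Represents P (MvPolynomial.homogeneousComponent (2 * k) G)) :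
    SameImage
      (∑ σ : Equiv.Perm (Fin k), ∑ τ : Equiv.Perm (Fin k),
        algebraMap (PolyRing k) (RatField k) (MvPolynomial.rename (Sum.map σ τ) P))
      (∑ σ : Equiv.Perm (Fin k), ∑ τ : Equiv.Perm (Fin k),
        gPrime (fun i => xVar (σ i)) (fun i => yVar (τ i)) θ m) := by
  have hsymm : ∀ Q : PolyRing k, ∑ σ : Equiv.Perm (Fin k), ∑ τ : Equiv.Perm (Fin k),
      algebraMap (PolyRing k) (RatField k) (MvPolynomial.rename (Sum.map σ τ) Q) =
      algebraMap (PolyRing k) (RatField k) (symm k Q) := fun Q => by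
    simp only [symm_apply, map_sum]
  have hdvd := dvd_symm_sub_polyMain θ m hk hG hP
  rw [map_sub] at hdvd
  rw [hsymm]
  refine (sameImage_of_dvd hdvd).trans ?_
  rw [← hsymm]
  exact SameImage.sum _ fun σ _ => SameImage.sum _ fun τ _ => sameImage_polyMain θ m hk hZ σ τ

end Main

end

end HigherOrderSumRule

open HigherOrderSumRule in
theorem theorem2 {K : ℕ} (θ : Fin K → ℝ) (hθ : ∀ j, θ j ∈ Set.Ico 0 (2 * Real.pi))
    (hinj : Function.Injective θ) (m : Fin K → ℕ) (hm : ∀ j, 0 < m j) :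
    -- local polynomials `G` for `Tr V(U_N)` exist
    (∃ G : LocalPoly (order m), IsTraceLocal θ m G ∧ G.totalDegree ≤ 2 * order m) ∧
    ∀ k : ℕ, 1 ≤ k →
      -- `G'_{2k}` is a Laurent polynomial
      (gPrime xVar yVar θ m : RatField k) ∈ laurentRing k ∧
      ∀ G : LocalPoly (order m), IsTraceLocal θ m G →
        -- `G_{2k}` is represented by an element of `A_{2k}` with the same image as `G'_{2k}`
        (∃ P : PolyRing k, Represents P (MvPolynomial.homogeneousComponent (2 * k) G) ∧
          SameImage (algebraMap (PolyRing k) (RatField k) P) (gPrime xVar yVar θ m)) ∧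
        -- and every representative has the same image as `G'_{2k}` after both are summed over all
        -- permutations of the `x_i` and of the `y_i`
        ∀ P : PolyRing k, Represents P (MvPolynomial.homogeneousComponent (2 * k) G) →
          SameImage
            (∑ σ : Equiv.Perm (Fin k), ∑ τ : Equiv.Perm (Fin k),
              algebraMap (PolyRing k) (RatField k) (MvPolynomial.rename (Sum.map σ τ) P))
            (∑ σ : Equiv.Perm (Fin k), ∑ τ : Equiv.Perm (Fin k),
              gPrime (fun i => xVar (σ i)) (fun i => yVar (τ i)) θ m) := by
  have hZ := (zH_pos θ m hθ).ne'
  refine ⟨⟨localTrace θ m, isTraceLocal_localTrace θ m, totalDegree_localTrace_le θ m⟩,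
    fun k hk => ⟨(sameImage_iff.1 (sameImage_polyMain_one θ m hk hZ)).2.1, fun G hG =>
      ⟨exists_represents_sameImage θ m hk hZ hG, fun P hP => sameImage_sum_perm θ m hk hZ hG hP⟩⟩⟩
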